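/- Let $E$ be a Polish space with Borel $\sigma$-field and let $\mu$ be a $\sigma$-finite measure on $E$. Let $\Gamma$ be the space of all at most countable sums $\gamma=\sum_i\delta_{x_i}$, $x_i\in E$ (including $0$), with the $\sigma$-field generated by $\gamma\mapsto\gamma(A)$, $A\subset E$ Borel, and let $\pi_\mu$ be the Poisson measure on $\Gamma$ with intensity $\mu$: the probability measure such that for disjoint Borel sets $A_1,\dots,A_n$ of finite $\mu$-measure and $k_1,\dots,k_n\in\mathbb Z_+$, $$\pi_\mu(\gamma(A_i)=k_i,\ 1\le i\le n)=\prod_{i=1}^n e^{-\mu(A_i)}\frac{\mu(A_i)^{k_i}}{k_i!}.$$ Let $\psi:\Gamma\times E\to[0,\infty)$ be measurable with $\psi_\mu(z):=\int_\Gamma\psi(\gamma,z)\,\pi_\mu(d\gamma)<\infty$ for $\mu$-a.e. $z$. Put $$\mathcal E^\psi(F,G)=\int_{\Gamma\times E}\big(F(\gamma+\delta_z)-F(\gamma)\big)\big(G(\gamma+\delta_z)-G(\gamma)\big)\,\psi(\gamma,z)\,\pi_\mu(d\gamma)\,\mu(dz),\qquad \mathcal D(\mathcal E^\psi)=\{F\in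 L^2(\pi_\mu):\mathcal E^\psi(F,F)<\infty\}.$$ Then: 1. (Well-definedness) If $A\subset\Gamma$ is $\pi_\mu$-null, then $\{(\gamma,z):\gamma+\delta_z\in A\}$ is $(\pi_\mu\times\mu)$-null. The quantities $\mathcal E^\psi(F,F)\in[0,\infty]$ and $\mathcal E^\psi(F,G)$ do not depend on the $\pi_\mu$-versions of $F$ and $G$, and for $F,G\in\mathcal D(\mathcal E^\psi)$ the integral defining $\mathcal E^\psi(F,G)$ converges absolutely. 2. $(\mathcal E^\psi,\mathcal D(\mathcal E^\psi))$ is a symmetric Dirichlet form on $L^2(\pi_\mu)$: $\mathcal D(\mathcal E^\psi)$ is a dense linear subspace of $L^2(\pi_\mu)$; $\mathcal E^\psi$ is a symmetric, nonnegative definite bilinear form on it; it is closed, i.e. $\mathcal D(\mathcal E^\psi)$ is complete for the norm $(\mathcal E^\psi(F,F)+\|F\|_{L^2(\pi_\mu)}^2)^{1/2}$; and for every $1$-Lipschitz $\varphi:\mathbb R\to\mathbb R$ with $\varphi(0)=0$ and every $F\in\mathcal D(\mathcal E^\psi)$ one has $\varphi(F)\in\mathcal D(\mathcal E^\psi)$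 and $\mathcal E^\psi(\varphi(F),\varphi(F))\le\mathcal E^\psi(F,F)$. 3. The form is conservative: $1\in\mathcal D(\mathcal E^\psi)$, $\mathcal E^\psi(1,1)=0$, and its resolvent satisfies $\alpha G_\alpha1=1$ for all $\alpha>0$, where $G_\alpha f\in\mathcal D(\mathcal E^\psi)$ is determined by $\mathcal E^\psi(G_\alpha f,v)+\alpha\langle G_\alpha f,v\rangle_{L^2(\pi_\mu)}=\langle f,v\rangle_{L^2(\pi_\mu)}$ for all $v\in\mathcal D(\mathcal E^\psi)$. 4. $\mathcal D(\mathcal E^\psi)$ contains (the class of) every cylindrical function $\gamma\mapsto f(\gamma(h_1),\dots,\gamma(h_m))$, where $m\ge1$, $f\in C_b^1(\mathbb R^m)$ (bounded and $C^1$ with bounded gradient), $h_i\in L^1(\mu)\cap L^\infty(\mu)$, $\gamma(h_i)=\int_E h_i\,d\gamma$, and $\|\psi_\mu 1_{\{h_i\ne0\}}\|_{L^\infty(\mu)}<\infty$ for each $i$. -/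

import Mathlib

open MeasureTheory ProbabilityTheory Filter Topology
open scoped ENNReal NNReal

namespace PoissonSpace

/-- The configuration space: all sums of at most countably many Dirac measures on `E` (repetitions
allowed, no local finiteness required, the empty sum being the zero measure). -/
abbrev Configuration (E : Type*) [MeasurableSpace E] : Type _ :=
  {γ : Measure E // ∃ (ι : Type) (_ : Countable ι) (x : ι → E),
    γ = Measure.sum fun i => Measure.dirac (x i)}

/-- The `σ`-field on the configuration space: Mathlib's `σ`-field on `Measure E` is the one
generated by the evaluations `γ ↦ γ A` for measurable `A`; here it is restricted. -/
instance instMeasurableSpaceConfiguration (E : Type*) [MeasurableSpace E] :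
    MeasurableSpace (Configuration E) :=
  Subtype.instMeasurableSpace

/-- The configuration `γ + δ_z`. -/
noncomputable def addPoint {E : Type*} [MeasurableSpace E] (γ : Configuration E) (z : E) :
    Configuration E :=
  ⟨γ.1 + Measure.dirac z, by
    obtain ⟨ι, hι, x, hx⟩ := γ.2
    refine ⟨ι ⊕ Unit, inferInstance, Sum.elim x fun _ => z, ?_⟩
    ext s hs
    rw [Measure.sum_apply _ hs, Measure.add_apply, hx, Measure.sum_apply _ hs,
      ENNReal.summable.tsum_sum ENNReal.summable]
    simp⟩

/-- `p(a, k) = e^{-a} a^k / k!`. -/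
noncomputable def poissonWeight (a : ℝ) (k : ℕ) : ℝ≥0∞ :=
  ENNReal.ofReal (Real.exp (-a) * a ^ k / (k.factorial : ℝ))

/-- The defining property of the Poisson measure with intensity `μ`: it is a probability measure on
the configuration space under which the counts of disjoint sets of finite `μ`-measure are
independent Poisson variables. -/
structure IsPoissonMeasure {E : Type*} [MeasurableSpace E] (μ : Measure E)
    (π : Measure (Configuration E)) : Prop where
  isProbabilityMeasure : IsProbabilityMeasure π
  apply_eq : ∀ (n : ℕ) (A : Fin n → Set E), (∀ i, MeasurableSet (A i)) →
    Pairwise (Function.onFun Disjoint A) → (∀ i, μ (A i) < ∞) → ∀ k : Fin n → ℕ,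
    π {γ | ∀ i, γ.1 (A i) = (k i : ℝ≥0∞)} = ∏ i, poissonWeight (μ (A i)).toReal (k i)

section Existence

/-! ### Existence of the Poisson measure -/

variable {E : Type*} [MeasurableSpace E]

theorem measurable_val : Measurable (fun γ : Configuration E => γ.1) := measurable_subtype_coe

theorem measurable_addPoint :
    Measurable (fun p : Configuration E × E => addPoint p.1 p.2) := by
  apply Measurable.subtype_mk
  exact (measurable_val.comp measurable_fst).add (Measure.measurable_dirac.comp measurable_snd)

theorem Configuration.nat_or_top (γ : Configuration E) {A : Set E} (hA : MeasurableSet A)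
    (h : γ.1 A ≠ ∞) : ∃ n : ℕ, γ.1 A = n := by
  obtain ⟨ι, hι, x, hx⟩ := γ.2
  have h1 : γ.1 A = (({i | x i ∈ A} : Set ι).encard : ℝ≥0∞) := by
    rw [hx, Measure.sum_apply _ hA]
    rw [← ENNReal.tsum_set_one, tsum_subtype ({i | x i ∈ A} : Set ι) fun _ => (1 : ℝ≥0∞)]
    refine tsum_congr fun i => ?_
    rw [Measure.dirac_apply' _ hA]
    simp [Set.indicator]
  rw [h1] at h ⊢
  generalize ({i | x i ∈ A} : Set ι).encard = c at h
  induction c using ENat.recTopCoe with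
  | top => simp at h
  | coe n => exact ⟨n, by simp⟩

/-- A random measure `M` on a probability space has the Poisson finite-dimensional distributions. -/
def Fidi {Ω : Type*} [MeasurableSpace Ω] (P : Measure Ω) (M : Ω → Measure E) (ν : Measure E) :
    Prop :=
  ∀ (n : ℕ) (A : Fin n → Set E), (∀ i, MeasurableSet (A i)) →
    Pairwise (Function.onFun Disjoint A) → (∀ i, ν (A i) < ∞) → ∀ k : Fin n → ℕ,
    P {ω | ∀ i, M ω (A i) = (k i : ℝ≥0∞)} = ∏ i, poissonWeight (ν (A i)).toReal (k i)

theorem poissonWeight_add (a b : ℝ) (ha : 0 ≤ a) (hb : 0 ≤ b) (k : ℕ) :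
    ∑ l ∈ Finset.HasAntidiagonal.antidiagonal k, poissonWeight a l.1 * poissonWeight b l.2 =
      poissonWeight (a + b) k := by
  unfold poissonWeight
  rw [Finset.sum_congr rfl fun l _ => (ENNReal.ofReal_mul (by positivity)).symm,
    ← ENNReal.ofReal_sum_of_nonneg (fun l _ => by positivity)]
  congr 1
  rw [(Commute.all a b).add_pow', Finset.mul_sum, Finset.sum_div]
  refine Finset.sum_congr rfl fun l hl => ?_
  have hl' : l.1 + l.2 = k := Finset.HasAntidiagonal.mem_antidiagonal.1 hl
  have hc : ((k.choose l.1 : ℕ) : ℝ) * (l.1.factorial * l.2.factorial) = k.factorial := by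
    subst hl'
    rw [← mul_assoc, Nat.choose_symm_add]
    exact_mod_cast Nat.add_choose_mul_factorial_mul_factorial l.1 l.2
  have h1 : (l.1.factorial : ℝ) ≠ 0 := by positivity
  have h2 : (l.2.factorial : ℝ) ≠ 0 := by positivity
  have h3 : (k.factorial : ℝ) ≠ 0 := by positivity
  rw [nsmul_eq_mul, neg_add, Real.exp_add]
  field_simp
  rw [← hc]; ring

theorem measurableSet_fidi {Ω : Type*} [MeasurableSpace Ω] {M : Ω → Measure E} (hM : Measurable M)
    {n : ℕ} {A : Fin n → Set E} (hA : ∀ i, MeasurableSet (A i)) (k : Fin n → ℕ) :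
    MeasurableSet {ω | ∀ i, M ω (A i) = (k i : ℝ≥0∞)} := by
  rw [Set.ofPred_forall]
  exact MeasurableSet.iInter fun i =>
    (measurableSet_singleton _).preimage ((Measure.measurable_coe (hA i)).comp hM)

theorem Fidi.add {Ω : Type*} [MeasurableSpace Ω] {P : Measure Ω} {M₁ M₂ : Ω → Measure E}
    {ν₁ ν₂ : Measure E} (m₁ : Measurable M₁) (m₂ : Measurable M₂) (hI : IndepFun M₁ M₂ P)
    (i₁ : ∀ ω A, MeasurableSet A → M₁ ω A ≠ ∞ → ∃ n : ℕ, M₁ ω A = n)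
    (i₂ : ∀ ω A, MeasurableSet A → M₂ ω A ≠ ∞ → ∃ n : ℕ, M₂ ω A = n)
    (h₁ : Fidi P M₁ ν₁) (h₂ : Fidi P M₂ ν₂) : Fidi P (M₁ + M₂) (ν₁ + ν₂) := by
  classical
  intro n A hA hd hf k
  have f₁ : ∀ i, ν₁ (A i) < ∞ := fun i => lt_of_le_of_lt (by simp) (hf i)
  have f₂ : ∀ i, ν₂ (A i) < ∞ := fun i => lt_of_le_of_lt (by simp) (hf i)
  let S (l : Fin n → ℕ × ℕ) : Set Ω :=
    {ω | ∀ i, M₁ ω (A i) = ((l i).1 : ℝ≥0∞)} ∩ {ω | ∀ i, M₂ ω (A i) = ((l i).2 : ℝ≥0∞)}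
  have hS : {ω | ∀ i, (M₁ + M₂) ω (A i) = (k i : ℝ≥0∞)} =
      ⋃ l ∈ Fintype.piFinset fun i => Finset.HasAntidiagonal.antidiagonal (k i), S l := by
    ext ω
    simp only [Pi.add_apply, Measure.add_apply, Set.mem_ofPred_eq, Fintype.mem_piFinset,
      Finset.HasAntidiagonal.mem_antidiagonal, Set.mem_iUnion, S, Set.mem_inter_iff, exists_prop]
    constructor
    · intro h
      have e₁ : ∀ i, ∃ m : ℕ, M₁ ω (A i) = m := fun i => i₁ ω _ (hA i) (by
        intro ht; have := h i; rw [ht] at this; simp at this)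
      have e₂ : ∀ i, ∃ m : ℕ, M₂ ω (A i) = m := fun i => i₂ ω _ (hA i) (by
        intro ht; have := h i; rw [ht] at this; simp at this)
      choose l₁ hl₁ using e₁
      choose l₂ hl₂ using e₂
      refine ⟨fun i => (l₁ i, l₂ i), fun i => ?_, hl₁, hl₂⟩
      have := h i
      rw [hl₁, hl₂] at this
      exact_mod_cast this
    · rintro ⟨l, hl, a, b⟩ i
      rw [a, b, ← hl i]; push_cast; rfl
  rw [hS, measure_biUnion_finset]
  · have : ∀ l, P (S l) = ∏ i, (poissonWeight (ν₁ (A i)).toReal (l i).1 *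
        poissonWeight (ν₂ (A i)).toReal (l i).2) := by
      intro l
      rw [Finset.prod_mul_distrib, ← h₁ n A hA hd f₁, ← h₂ n A hA hd f₂]
      exact hI.measure_inter_preimage_eq_mul _ _
        (measurableSet_fidi (M := fun γ : Measure E => γ) measurable_id hA fun i => (l i).1)
        (measurableSet_fidi (M := fun γ : Measure E => γ) measurable_id hA fun i => (l i).2)
    simp_rw [this]
    rw [← Finset.prod_univ_sum (fun i => Finset.HasAntidiagonal.antidiagonal (k i)) fun i l =>
      poissonWeight (ν₁ (A i)).toReal l.1 * poissonWeight (ν₂ (A i)).toReal l.2]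
    refine Finset.prod_congr rfl fun i _ => ?_
    rw [Measure.add_apply, ENNReal.toReal_add (f₁ i).ne (f₂ i).ne]
    exact poissonWeight_add _ _ ENNReal.toReal_nonneg ENNReal.toReal_nonneg _
  · intro l _ l' _ hne
    refine Set.disjoint_left.2 fun ω hω hω' => hne ?_
    funext i
    refine Prod.ext ?_ ?_
    · have := (hω.1 i).symm.trans (hω'.1 i); exact_mod_cast this
    · have := (hω.2 i).symm.trans (hω'.2 i); exact_mod_cast this
  · intro l _
    exact (measurableSet_fidi m₁ hA _).inter (measurableSet_fidi m₂ hA _)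

/-- The empty configuration. -/
noncomputable def zeroConfiguration : Configuration E :=
  ⟨0, Empty, inferInstance, Empty.elim, by simp⟩

/-- The law of `∑_{i<n} δ_{X_i}`, unnormalised, for a finite intensity. -/
noncomputable def binomialLaw (μ : Measure E) : ℕ → Measure (Configuration E)
  | 0 => Measure.dirac zeroConfiguration
  | n + 1 => ((binomialLaw μ n).prod μ).map fun p => addPoint p.1 p.2

/-- `n! / (∏ k_i! (n - ∑ k_i)!) ∏ a_i^{k_i} c^{n - ∑ k_i}`, divided by `n!`. -/
noncomputable def multWeight {r : ℕ} (a : Fin r → ℝ) (c : ℝ) (n : ℕ) (k : Fin r → ℕ) : ℝ :=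
  if ∑ i, k i ≤ n then
    (∏ i, a i ^ k i / ((k i).factorial : ℝ)) * (c ^ (n - ∑ i, k i) / ((n - ∑ i, k i).factorial : ℝ))
  else 0

theorem multWeight_succ {r : ℕ} (a : Fin r → ℝ) (c : ℝ) (n : ℕ) (k : Fin r → ℕ) :
    (n + 1 : ℝ) * multWeight a c (n + 1) k = c * multWeight a c n k +
      ∑ j, if k j = 0 then 0 else a j * multWeight a c n (Function.update k j (k j - 1)) := by
  have hs : ∀ j, k j ≠ 0 → ∑ i, Function.update k j (k j - 1) i + 1 = ∑ i, k i := by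
    intro j hj
    have h1 := Finset.add_sum_erase Finset.univ k (Finset.mem_univ j)
    have h2 := Finset.sum_update_of_mem (Finset.mem_univ j) k (k j - 1)
    rw [Finset.sdiff_singleton_eq_erase] at h2
    omega
  have key : ∀ j, (if k j = 0 then 0 else a j * multWeight a c n (Function.update k j (k j - 1))) =
      (k j : ℝ) * multWeight a c (n + 1) k := by
    intro j
    split_ifs with hj
    · simp [hj]
    · have h1 := hs j hj
      unfold multWeight
      by_cases hn : ∑ i, k i ≤ n + 1
      · rw [if_pos hn, if_pos (by omega)]
        have e : n - ∑ i, Function.update k j (k j - 1) i = n + 1 - ∑ i, k i := by omega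
        rw [e]
        have hp : ∏ i, a i ^ k i / ((k i).factorial : ℝ) =
            (a j ^ k j / ((k j).factorial : ℝ)) *
              ∏ i ∈ Finset.univ.erase j, a i ^ k i / ((k i).factorial : ℝ) :=
          (Finset.mul_prod_erase _ _ (Finset.mem_univ j)).symm
        have hp' : ∏ i, a i ^ (Function.update k j (k j - 1) i) /
              ((Function.update k j (k j - 1) i).factorial : ℝ) =
            (a j ^ (k j - 1) / ((k j - 1).factorial : ℝ)) *
              ∏ i ∈ Finset.univ.erase j, a i ^ k i / ((k i).factorial : ℝ) := by
          rw [← Finset.mul_prod_erase _ _ (Finset.mem_univ j)]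
          congr 1
          · simp
          · refine Finset.prod_congr rfl fun i hi => ?_
            rw [Function.update_of_ne (Finset.ne_of_mem_erase hi)]
        rw [hp, hp']
        obtain ⟨q, hq⟩ := Nat.exists_eq_succ_of_ne_zero hj
        rw [hq]
        simp only [Nat.succ_eq_add_one, Nat.add_sub_cancel, Nat.factorial_succ, pow_succ]
        push_cast
        have : (q.factorial : ℝ) ≠ 0 := by positivity
        field_simp
      · rw [if_neg hn, if_neg (by omega)]; simp
  rw [Finset.sum_congr rfl fun j _ => key j, ← Finset.sum_mul, ← Nat.cast_sum]
  unfold multWeight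
  by_cases hn : ∑ i, k i ≤ n
  · rw [if_pos hn, if_pos (by omega)]
    obtain ⟨d, hd⟩ := Nat.exists_eq_add_of_le hn
    have e1 : n - ∑ i, k i = d := by omega
    have e2 : n + 1 - ∑ i, k i = d + 1 := by omega
    have e3 : (n : ℝ) = (∑ i, k i : ℕ) + d := by rw [hd]; push_cast; rfl
    rw [e1, e2, e3, Nat.factorial_succ, pow_succ]
    push_cast
    have : (d.factorial : ℝ) ≠ 0 := by positivity
    field_simp
    ring
  · rw [if_neg hn]
    by_cases hn' : ∑ i, k i ≤ n + 1
    · have e3 : ((∑ i, k i : ℕ) : ℝ) = n + 1 := by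
        have : ∑ i, k i = n + 1 := by omega
        rw [this]; push_cast; rfl
      rw [e3]; ring
    · rw [if_neg hn']; ring

theorem multWeight_nonneg {r : ℕ} {a : Fin r → ℝ} {c : ℝ} (ha : ∀ i, 0 ≤ a i) (hc : 0 ≤ c)
    (n : ℕ) (k : Fin r → ℕ) : 0 ≤ multWeight a c n k := by
  unfold multWeight
  split_ifs
  · exact mul_nonneg (Finset.prod_nonneg fun i _ => div_nonneg (pow_nonneg (ha i) _) (by positivity))
      (by positivity)
  · exact le_rfl

theorem hasSum_multWeight {r : ℕ} (a : Fin r → ℝ) (c : ℝ) (k : Fin r → ℕ) :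
    HasSum (fun n => multWeight a c n k)
      ((∏ i, a i ^ k i / ((k i).factorial : ℝ)) * Real.exp c) := by
  have h : HasSum (fun n : ℕ => c ^ n / (n.factorial : ℝ)) (Real.exp c) := by
    rw [Real.exp_eq_exp_ℝ]; exact NormedSpace.expSeries_div_hasSum_exp c
  have h2 := h.mul_left (∏ i, a i ^ k i / ((k i).factorial : ℝ))
  have hz : ∀ n ∉ Set.range (fun n => n + ∑ i, k i), multWeight a c n k = 0 := by
    intro n hn
    unfold multWeight
    rw [if_neg]
    intro hle
    exact hn ⟨n - ∑ i, k i, Nat.sub_add_cancel hle⟩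
  refine ((add_left_injective (∑ i, k i)).hasSum_iff hz).1 ?_
  refine h2.congr_fun fun n => ?_
  simp [multWeight]

instance sFinite_binomialLaw (μ : Measure E) [IsFiniteMeasure μ] (n : ℕ) :
    IsFiniteMeasure (binomialLaw μ n) := by
  induction n with
  | zero => unfold binomialLaw; infer_instance
  | succ n ih => unfold binomialLaw; infer_instance

theorem binomialLaw_apply (μ : Measure E) [IsFiniteMeasure μ] {r : ℕ} {A : Fin r → Set E}
    (hA : ∀ i, MeasurableSet (A i)) (hd : Pairwise (Function.onFun Disjoint A)) (n : ℕ)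
    (k : Fin r → ℕ) :
    binomialLaw μ n {γ | ∀ i, γ.1 (A i) = (k i : ℝ≥0∞)} =
      ENNReal.ofReal (n.factorial *
        multWeight (fun i => (μ (A i)).toReal) (μ (⋃ i, A i)ᶜ).toReal n k) := by
  classical
  set a : Fin r → ℝ := fun i => (μ (A i)).toReal with ha
  set c : ℝ := (μ (⋃ i, A i)ᶜ).toReal with hc
  have ha0 : ∀ i, 0 ≤ a i := fun i => ENNReal.toReal_nonneg
  have hc0 : 0 ≤ c := ENNReal.toReal_nonneg
  induction n generalizing k with
  | zero =>
    unfold binomialLaw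
    rw [Measure.dirac_apply' _ (measurableSet_fidi measurable_val hA k)]
    by_cases hk : ∀ i, k i = 0
    · have : k = 0 := funext hk
      subst this
      simp [multWeight, Set.indicator, zeroConfiguration]
    · have hs : ¬ (∑ i, k i ≤ 0) := by
        intro h; exact hk (by simpa using h)
      have : multWeight a c 0 k = 0 := by unfold multWeight; rw [if_neg hs]
      rw [this]
      push Not at hk
      obtain ⟨i, hi⟩ := hk
      rw [Set.indicator_of_notMem]
      · simp
      · intro h
        have := h i
        simp only [zeroConfiguration, Measure.coe_zero, Pi.zero_apply] at this
        exact hi (by exact_mod_cast this.symm)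
  | succ n ih =>
    have hS := measurableSet_fidi (E := E) measurable_val hA k
    have hU : MeasurableSet (⋃ i, A i)ᶜ := (MeasurableSet.iUnion hA).compl
    rw [binomialLaw, Measure.map_apply measurable_addPoint hS,
      Measure.prod_apply_symm (measurable_addPoint hS)]
    have hf : ∀ z, binomialLaw μ n ((fun x => (x, z)) ⁻¹'
          ((fun p : Configuration E × E => addPoint p.1 p.2) ⁻¹'
            {γ | ∀ i, γ.1 (A i) = (k i : ℝ≥0∞)})) =
        (⋃ i, A i)ᶜ.indicator (fun _ => ENNReal.ofReal (n.factorial * multWeight a c n k)) z +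
        ∑ j, (A j).indicator (fun _ => ENNReal.ofReal (n.factorial * if k j = 0 then 0 else
          multWeight a c n (Function.update k j (k j - 1)))) z := by
      intro z
      have hpre : ((fun x => (x, z)) ⁻¹'
          ((fun p : Configuration E × E => addPoint p.1 p.2) ⁻¹'
            {γ : Configuration E | ∀ i, γ.1 (A i) = (k i : ℝ≥0∞)})) =
          {γ | ∀ i, γ.1 (A i) + (A i).indicator 1 z = (k i : ℝ≥0∞)} := by
        ext γ
        simp only [Set.mem_preimage, Set.mem_ofPred_eq, addPoint, Measure.add_apply]
        refine forall_congr' fun i => ?_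
        rw [Measure.dirac_apply' _ (hA i)]
      rw [hpre]
      by_cases hz : z ∈ ⋃ i, A i
      · obtain ⟨j, hj⟩ := Set.mem_iUnion.1 hz
        have hne : ∀ i, i ≠ j → z ∉ A i := fun i hi h =>
          Set.disjoint_left.1 (hd hi) h hj
        rw [Set.indicator_of_notMem (by simpa using ⟨j, hj⟩),
          Finset.sum_eq_single j (fun i _ hi => Set.indicator_of_notMem (hne i hi) _) (by simp),
          Set.indicator_of_mem hj, zero_add]
        split_ifs with hk
        · have : {γ : Configuration E | ∀ i, γ.1 (A i) + (A i).indicator 1 z = (k i : ℝ≥0∞)} =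
              ∅ := by
            ext γ
            simp only [Set.mem_ofPred_eq, Set.mem_empty_iff_false, iff_false, not_forall]
            refine ⟨j, ?_⟩
            rw [Set.indicator_of_mem hj, hk]
            simp
          rw [this]; simp
        · rw [← ih]
          congr 1
          ext γ
          simp only [Set.mem_ofPred_eq]
          refine forall_congr' fun i => ?_
          by_cases hij : i = j
          · subst hij
            rw [Set.indicator_of_mem hj, Function.update_self]
            obtain ⟨q, hq⟩ := Nat.exists_eq_succ_of_ne_zero hk
            rw [hq]
            simp only [Nat.succ_eq_add_one, Nat.add_sub_cancel, Pi.one_apply]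
            push_cast
            exact ENNReal.add_left_inj (by simp)
          · rw [Set.indicator_of_notMem (hne i hij), Function.update_of_ne hij, add_zero]
      · have hne : ∀ i, z ∉ A i := fun i h => hz (Set.mem_iUnion.2 ⟨i, h⟩)
        rw [Set.indicator_of_mem (by exact hz),
          Finset.sum_eq_zero fun i _ => Set.indicator_of_notMem (hne i) _, add_zero, ← ih]
        congr 1
        ext γ
        simp [hne]
    simp_rw [hf]
    rw [lintegral_add_left (measurable_const.indicator hU),
      lintegral_finsetSum _ fun j _ => measurable_const.indicator (hA j),
      lintegral_indicator_const hU]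
    simp_rw [lintegral_indicator_const (hA _)]
    have e1 : ∀ B : Set E, μ B = ENNReal.ofReal (μ B).toReal := fun B =>
      (ENNReal.ofReal_toReal (measure_ne_top μ B)).symm
    have nn : ∀ k, 0 ≤ multWeight a c n k := multWeight_nonneg ha0 hc0 n
    have nn' : ∀ j, 0 ≤ (n.factorial : ℝ) * (if k j = 0 then 0 else
          multWeight a c n (Function.update k j (k j - 1))) := fun j =>
      mul_nonneg (by positivity) (by split_ifs; exacts [le_rfl, nn _])
    rw [e1 (⋃ i, A i)ᶜ, ← ENNReal.ofReal_mul (mul_nonneg (by positivity) (nn _))]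
    have e2 : ∀ j, ENNReal.ofReal (n.factorial * if k j = 0 then 0 else
          multWeight a c n (Function.update k j (k j - 1))) * μ (A j) =
        ENNReal.ofReal ((n.factorial * if k j = 0 then 0 else
          multWeight a c n (Function.update k j (k j - 1))) * a j) := fun j => by
      rw [e1 (A j), ← ENNReal.ofReal_mul (nn' j)]
    rw [Finset.sum_congr rfl fun j _ => e2 j,
      ← ENNReal.ofReal_sum_of_nonneg fun j _ => mul_nonneg (nn' j) (ha0 j),
      ← ENNReal.ofReal_add (mul_nonneg (mul_nonneg (by positivity) (nn _)) hc0)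
        (Finset.sum_nonneg fun j _ => mul_nonneg (nn' j) (ha0 j))]
    congr 1
    rw [Nat.factorial_succ]
    have := multWeight_succ a c n k
    push_cast
    rw [mul_comm ((n : ℝ) + 1), mul_assoc (n.factorial : ℝ) ((n : ℝ) + 1), this, mul_add, Finset.mul_sum]
    congr 1
    · ring
    · refine Finset.sum_congr rfl fun j _ => ?_
      split_ifs <;> ring

theorem exists_isPoissonMeasure_of_finite (μ : Measure E) [IsFiniteMeasure μ] :
    ∃ π, IsPoissonMeasure μ π := by
  let π : Measure (Configuration E) := ENNReal.ofReal (Real.exp (-(μ Set.univ).toReal)) •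
    Measure.sum fun n : ℕ => ENNReal.ofReal (1 / (n.factorial : ℝ)) • binomialLaw μ n
  have key : ∀ (r : ℕ) (A : Fin r → Set E), (∀ i, MeasurableSet (A i)) →
      Pairwise (Function.onFun Disjoint A) → ∀ k : Fin r → ℕ,
      π {γ | ∀ i, γ.1 (A i) = (k i : ℝ≥0∞)} = ∏ i, poissonWeight (μ (A i)).toReal (k i) := by
    intro r A hA hd k
    have ha0 : ∀ i, 0 ≤ (μ (A i)).toReal := fun i => ENNReal.toReal_nonneg
    have hc0 : 0 ≤ (μ (⋃ i, A i)ᶜ).toReal := ENNReal.toReal_nonneg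
    have hS := measurableSet_fidi (E := E) measurable_val hA k
    have hU : MeasurableSet (⋃ i, A i) := MeasurableSet.iUnion hA
    simp only [π, Measure.smul_apply, smul_eq_mul]
    rw [Measure.sum_apply _ hS]
    simp only [Measure.smul_apply, smul_eq_mul, binomialLaw_apply μ hA hd]
    have e : ∀ n : ℕ, ENNReal.ofReal (1 / (n.factorial : ℝ)) * ENNReal.ofReal (n.factorial *
        multWeight (fun i => (μ (A i)).toReal) (μ (⋃ i, A i)ᶜ).toReal n k) =
        ENNReal.ofReal (multWeight (fun i => (μ (A i)).toReal) (μ (⋃ i, A i)ᶜ).toReal n k) := by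
      intro n
      rw [← ENNReal.ofReal_mul (by positivity)]
      congr 1
      have : (n.factorial : ℝ) ≠ 0 := by positivity
      field_simp
    have hs := hasSum_multWeight (fun i => (μ (A i)).toReal) (μ (⋃ i, A i)ᶜ).toReal k
    simp_rw [e]
    rw [← ENNReal.ofReal_tsum_of_nonneg (multWeight_nonneg ha0 hc0 · k) hs.summable, hs.tsum_eq,
      ← ENNReal.ofReal_mul (by positivity)]
    unfold poissonWeight
    rw [← ENNReal.ofReal_prod_of_nonneg fun i _ => by positivity]
    congr 1
    have hm : (μ Set.univ).toReal = ∑ i, (μ (A i)).toReal + (μ (⋃ i, A i)ᶜ).toReal := by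
      rw [← ENNReal.toReal_sum fun i _ => measure_ne_top _ _,
        ← ENNReal.toReal_add (by simp) (measure_ne_top _ _), ← measure_add_measure_compl hU,
        measure_iUnion hd hA, tsum_fintype]
    simp_rw [mul_div_assoc]
    rw [Finset.prod_mul_distrib, ← Real.exp_sum, hm, Finset.sum_neg_distrib, neg_add, Real.exp_add,
      Real.exp_neg (μ (⋃ i, A i)ᶜ).toReal]
    have := Real.exp_ne_zero (μ (⋃ i, A i)ᶜ).toReal
    field_simp
  refine ⟨π, ⟨⟨?_⟩, fun n A hA hd _ k => key n A hA hd k⟩⟩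
  have := key 0 (fun i => i.elim0) (fun i => i.elim0) (fun i => i.elim0) (fun i => i.elim0)
  simpa using this

/-- Superposition of a sequence of configurations. -/
noncomputable def superpose (γ : ℕ → Configuration E) : Configuration E :=
  ⟨Measure.sum fun n => (γ n).1, by
    choose ι hι x hx using fun n => (γ n).2
    refine ⟨Σ n, ι n, inferInstance, fun p => x p.1 p.2, ?_⟩
    ext s hs
    rw [Measure.sum_apply _ hs, Measure.sum_apply _ hs, ENNReal.tsum_sigma']
    refine tsum_congr fun n => ?_
    rw [hx n, Measure.sum_apply _ hs]⟩

theorem measurable_superpose : Measurable (superpose (E := E)) := by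
  refine Measurable.subtype_mk (Measure.measurable_of_measurable_coe _ fun s hs => ?_)
  simp_rw [Measure.sum_apply _ hs]
  exact Measurable.tsum fun n =>
    (Measure.measurable_coe hs).comp (measurable_val.comp (measurable_pi_apply n))

theorem exists_isPoissonMeasure (μ : Measure E) [SFinite μ] : ∃ π, IsPoissonMeasure μ π := by
  classical
  set ν := sfiniteSeq μ with hν
  choose p hp using fun n => exists_isPoissonMeasure_of_finite (ν n)
  have : ∀ n, IsProbabilityMeasure (p n) := fun n => (hp n).1
  let P := Measure.infinitePi p
  let X : ℕ → (ℕ → Configuration E) → Measure E := fun n ω => (ω n).1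
  have mX : ∀ n, Measurable (X n) := fun n => measurable_val.comp (measurable_pi_apply n)
  have iX : iIndepFun X P :=
    iIndepFun_infinitePi (X := fun _ (γ : Configuration E) => γ.1) fun _ => measurable_val
  have hX : ∀ n, Fidi P (X n) (ν n) := by
    intro n r A hA hd hf k
    have h1 := (hp n).2 r A hA hd hf k
    rw [← Measure.infinitePi_map_eval p n, Measure.map_apply (measurable_pi_apply n)
      (measurableSet_fidi measurable_val hA k)] at h1
    exact h1
  have nX : ∀ N ω A, MeasurableSet A → (∑ n ∈ Finset.range N, X n) ω A ≠ ∞ →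
      ∃ q : ℕ, (∑ n ∈ Finset.range N, X n) ω A = q := by
    intro N ω A hA h
    rw [Finset.sum_apply, Measure.finsetSum_apply] at h ⊢
    have h' : ∀ n ∈ Finset.range N, ∃ q : ℕ, X n ω A = q := fun n hn =>
      (ω n).nat_or_top hA (ENNReal.sum_ne_top.1 h n hn)
    choose! q hq using h'
    exact ⟨∑ n ∈ Finset.range N, q n, by rw [Finset.sum_congr rfl hq]; push_cast; rfl⟩
  have mSum : ∀ N, Measurable (∑ n ∈ Finset.range N, X n) := fun N =>
    by simpa only [Finset.sum_fn] using Finset.measurable_sum (Finset.range N) fun n _ => mX n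
  have hS : ∀ N, Fidi P (∑ n ∈ Finset.range N, X n) (∑ n ∈ Finset.range N, ν n) := by
    intro N
    induction N with
    | zero =>
      intro r A hA hd hf k
      by_cases hk : ∀ i, k i = 0
      · simp [hk, poissonWeight]
      · push Not at hk
        obtain ⟨i, hi⟩ := hk
        rw [Finset.prod_eq_zero (Finset.mem_univ i)]
        · convert measure_empty (μ := P)
          ext ω
          simp only [Set.mem_ofPred_eq, Set.mem_empty_iff_false, iff_false, not_forall]
          exact ⟨i, by simpa using fun h : (0 : ℝ≥0∞) = k i => hi (by exact_mod_cast h.symm)⟩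
        · simp [poissonWeight, hi]
    | succ N ih =>
      rw [Finset.sum_range_succ, Finset.sum_range_succ]
      refine Fidi.add (mSum _) (mX N)
        (iX.indepFun_finsetSum_of_notMem mX (by simp)) (nX N) ?_ ih (hX N)
      exact fun ω A hA h => (ω N).nat_or_top hA h
  have : IsProbabilityMeasure P := inferInstance
  refine ⟨P.map superpose, ⟨Measure.isProbabilityMeasure_map measurable_superpose.aemeasurable, ?_⟩⟩
  intro r A hA hd hf k
  rw [Measure.map_apply measurable_superpose (measurableSet_fidi measurable_val hA k)]
  have t1 : Tendsto (fun N => P {ω | ∀ i, (∑ n ∈ Finset.range N, X n) ω (A i) = (k i : ℝ≥0∞)}) atTop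
      (𝓝 (P (superpose ⁻¹' {γ | ∀ i, γ.1 (A i) = (k i : ℝ≥0∞)}))) := by
    refine tendsto_measure_of_tendsto_indicator_of_isFiniteMeasure atTop P
      (fun N => measurableSet_fidi (mSum N) hA k) fun ω => ?_
    have hi : ∀ i, ∀ᶠ N in atTop, ((∑ n ∈ Finset.range N, X n) ω (A i) = (k i : ℝ≥0∞) ↔
        (superpose ω).1 (A i) = (k i : ℝ≥0∞)) := by
      intro i
      have es : (superpose ω).1 (A i) = ∑' n, X n ω (A i) := Measure.sum_apply _ (hA i)
      have eu : ∀ N, (∑ n ∈ Finset.range N, X n) ω (A i) = ∑ n ∈ Finset.range N, X n ω (A i) := by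
        intro N; rw [Finset.sum_apply, Measure.finsetSum_apply]
      have ht : Tendsto (fun N => (∑ n ∈ Finset.range N, X n) ω (A i)) atTop
          (𝓝 ((superpose ω).1 (A i))) := by
        simp_rw [eu, es]; exact ENNReal.tendsto_nat_tsum _
      have hle : ∀ N, (∑ n ∈ Finset.range N, X n) ω (A i) ≤ (superpose ω).1 (A i) := by
        intro N; rw [eu, es]; exact ENNReal.sum_le_tsum _
      by_cases htop : (superpose ω).1 (A i) = ∞
      · rw [htop] at ht
        filter_upwards [ht.eventually (lt_mem_nhds (ENNReal.natCast_lt_top (k i)))] with N hN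
        rw [htop]
        exact ⟨fun h => absurd h hN.ne', fun h => by simp at h⟩
      · obtain ⟨q, hq⟩ := (superpose ω).nat_or_top (hA i) htop
        suffices h : ∀ᶠ N in atTop, (∑ n ∈ Finset.range N, X n) ω (A i) = (superpose ω).1 (A i) by
          filter_upwards [h] with N hN
          rw [hN]
        rw [hq] at ht hle ⊢
        cases q with
        | zero => exact .of_forall fun N => le_antisymm (hle N) (by simp)
        | succ q =>
          filter_upwards [ht.eventually (lt_mem_nhds (b := ((q + 1 : ℕ) : ℝ≥0∞))
            (a := (q : ℝ≥0∞)) (by exact_mod_cast Nat.lt_succ_self q))] with N hN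
          refine le_antisymm (hle N) ?_
          obtain ⟨p, hp⟩ := nX N ω (A i) (hA i) ((hle N).trans_lt (ENNReal.natCast_lt_top _)).ne
          rw [hp] at hN ⊢
          exact_mod_cast Nat.succ_le_of_lt (by exact_mod_cast hN)
    filter_upwards [eventually_all.2 hi] with N hN
    exact forall_congr' hN
  have hfin : ∀ N i, (∑ n ∈ Finset.range N, ν n) (A i) ≤ μ (A i) := by
    intro N i
    conv_rhs => rw [← sum_sfiniteSeq μ, Measure.sum_apply _ (hA i)]
    rw [Measure.finsetSum_apply]
    exact ENNReal.sum_le_tsum _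
  have t2 : Tendsto (fun N => P {ω | ∀ i, (∑ n ∈ Finset.range N, X n) ω (A i) = (k i : ℝ≥0∞)}) atTop
      (𝓝 (∏ i, poissonWeight (μ (A i)).toReal (k i))) := by
    have e : ∀ N, P {ω | ∀ i, (∑ n ∈ Finset.range N, X n) ω (A i) = (k i : ℝ≥0∞)} =
        ENNReal.ofReal (∏ i, (Real.exp (-((∑ n ∈ Finset.range N, ν n) (A i)).toReal) *
          ((∑ n ∈ Finset.range N, ν n) (A i)).toReal ^ k i / ((k i).factorial : ℝ))) := by
      intro N
      rw [hS N r A hA hd (fun i => (hfin N i).trans_lt (hf i)) k,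
        ENNReal.ofReal_prod_of_nonneg fun i _ => by positivity]
      rfl
    have e' : ∏ i, poissonWeight (μ (A i)).toReal (k i) =
        ENNReal.ofReal (∏ i, (Real.exp (-(μ (A i)).toReal) *
          (μ (A i)).toReal ^ k i / ((k i).factorial : ℝ))) := by
      rw [ENNReal.ofReal_prod_of_nonneg fun i _ => by positivity]
      rfl
    simp_rw [e]
    rw [e']
    refine ENNReal.tendsto_ofReal (tendsto_finsetProd _ fun i _ => ?_)
    have hc : Tendsto (fun N => ((∑ n ∈ Finset.range N, ν n) (A i)).toReal) atTop
        (𝓝 (μ (A i)).toReal) := by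
      refine (ENNReal.tendsto_toReal (hf i).ne).comp ?_
      conv => rhs; rw [← sum_sfiniteSeq μ, Measure.sum_apply _ (hA i)]
      simp_rw [Measure.finsetSum_apply]
      exact ENNReal.tendsto_nat_tsum _
    exact (((Real.continuous_exp.tendsto _).comp hc.neg).mul (hc.pow _)).div_const _
  exact tendsto_nhds_unique t1 t2

end Existence

/-- The Poisson measure `π_μ` with intensity `μ`. -/
noncomputable def poissonLaw {E : Type*} [MeasurableSpace E] (μ : Measure E) [SFinite μ] :
    Measure (Configuration E) :=
  (exists_isPoissonMeasure μ).choose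

theorem isPoissonMeasure_poissonLaw {E : Type*} [MeasurableSpace E] (μ : Measure E) [SFinite μ] :
    IsPoissonMeasure μ (poissonLaw μ) :=
  (exists_isPoissonMeasure μ).choose_spec

instance isProbabilityMeasure_poissonLaw {E : Type*} [MeasurableSpace E] (μ : Measure E)
    [SFinite μ] : IsProbabilityMeasure (poissonLaw μ) :=
  (isPoissonMeasure_poissonLaw μ).isProbabilityMeasure

section DirichletForms

/-! ### Symmetric Dirichlet forms on a real `L²` space -/

/-- `Q`, with domain `D`, is a symmetric Dirichlet form on `L²(ν)`: a densely defined, nonnegative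
definite, symmetric bilinear form, which is closed (the domain is complete for the norm
`(Q(u,u) + ‖u‖²)^{1/2}`) and on which every normal contraction operates (in particular the unit
contraction `u ↦ min (max u 0) 1`). The values of `Q` outside `D × D` are irrelevant. -/
structure IsSymmetricDirichletForm {X : Type*} [MeasurableSpace X] (ν : Measure X)
    (D : Set (Lp ℝ 2 ν)) (Q : Lp ℝ 2 ν → Lp ℝ 2 ν → ℝ) : Prop where
  zero_mem : (0 : Lp ℝ 2 ν) ∈ D
  add_mem : ∀ u ∈ D, ∀ v ∈ D, u + v ∈ D
  smul_mem : ∀ (c : ℝ), ∀ u ∈ D, c • u ∈ D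
  dense : Dense D
  add_left : ∀ u ∈ D, ∀ v ∈ D, ∀ w ∈ D, Q (u + v) w = Q u w + Q v w
  smul_left : ∀ (c : ℝ), ∀ u ∈ D, ∀ v ∈ D, Q (c • u) v = c * Q u v
  symm : ∀ u ∈ D, ∀ v ∈ D, Q u v = Q v u
  nonneg : ∀ u ∈ D, 0 ≤ Q u u
  closed : ∀ u : ℕ → Lp ℝ 2 ν, (∀ n, u n ∈ D) →
    (∀ ε > 0, ∃ N, ∀ m ≥ N, ∀ n ≥ N, Q (u m - u n) (u m - u n) + ‖u m - u n‖ ^ 2 < ε) →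
    ∃ v ∈ D, Tendsto (fun n => Q (u n - v) (u n - v) + ‖u n - v‖ ^ 2) atTop (𝓝 0)
  contraction : ∀ (φ : ℝ → ℝ) (hφ : LipschitzWith 1 φ) (h0 : φ 0 = 0), ∀ u ∈ D,
    hφ.compLp h0 u ∈ D ∧ Q (hφ.compLp h0 u) (hφ.compLp h0 u) ≤ Q u u

/-- `g = G_α f`, where `(G_α)_{α>0}` is the resolvent of the form `(Q, D)`: `g ∈ D` and
`Q(g, v) + α ⟨g, v⟩ = ⟨f, v⟩` for all `v ∈ D`. -/
def IsResolvent {X : Type*} [MeasurableSpace X] {ν : Measure X}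
    (D : Set (Lp ℝ 2 ν)) (Q : Lp ℝ 2 ν → Lp ℝ 2 ν → ℝ) (α : ℝ) (f g : Lp ℝ 2 ν) : Prop :=
  g ∈ D ∧ ∀ v ∈ D, Q g v + α * inner ℝ g v = inner ℝ f v

/-- Conservativeness of a form on `L²` of a finite measure: `1 ∈ D` and `Q(1, 1) = 0`, and the
resolvent satisfies `α G_α 1 = 1` for all `α > 0` (by the Laplace transform this says that the
associated semigroup satisfies `P_t 1 = 1` for all `t`). -/
structure IsConservative {X : Type*} [MeasurableSpace X] {ν : Measure X} [IsFiniteMeasure ν]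
    (D : Set (Lp ℝ 2 ν)) (Q : Lp ℝ 2 ν → Lp ℝ 2 ν → ℝ) : Prop where
  one_mem : Lp.const 2 ν (1 : ℝ) ∈ D
  form_one : Q (Lp.const 2 ν (1 : ℝ)) (Lp.const 2 ν (1 : ℝ)) = 0
  resolvent_one : ∀ α : ℝ, 0 < α →
    IsResolvent D Q α (Lp.const 2 ν (1 : ℝ)) (α⁻¹ • Lp.const 2 ν (1 : ℝ))

end DirichletForms

section BirthDeath

/-! ### The weighted birth-death form -/

variable {E : Type*} [MeasurableSpace E]

/-- `D_z F(γ) = F(γ + δ_z) - F(γ)`. -/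
noncomputable def difference (F : Configuration E → ℝ) (p : Configuration E × E) : ℝ :=
  F (addPoint p.1 p.2) - F p.1

/-- `ψ_μ(z) = ∫ ψ(γ, z) π_μ(dγ)`. -/
noncomputable def meanWeight (μ : Measure E) [SFinite μ] (ψ : Configuration E → E → ℝ≥0) (z : E) :
    ℝ≥0∞ :=
  ∫⁻ γ, ψ γ z ∂(poissonLaw μ)

/-- `𝓔^ψ(F, F) ∈ [0, ∞]`. -/
noncomputable def energy (μ : Measure E) [SFinite μ] (ψ : Configuration E → E → ℝ≥0)
    (F : Configuration E → ℝ) : ℝ≥0∞ :=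
  ∫⁻ p, ENNReal.ofReal (difference F p ^ 2) * ψ p.1 p.2 ∂((poissonLaw μ).prod μ)

/-- `𝓔^ψ(F, G)`. -/
noncomputable def form (μ : Measure E) [SFinite μ] (ψ : Configuration E → E → ℝ≥0)
    (F G : Configuration E → ℝ) : ℝ :=
  ∫ p, difference F p * difference G p * ψ p.1 p.2 ∂((poissonLaw μ).prod μ)

/-- `𝓓(𝓔^ψ) = {F ∈ L²(π_μ) : 𝓔^ψ(F, F) < ∞}`. -/
def domain (μ : Measure E) [SFinite μ] (ψ : Configuration E → E → ℝ≥0) :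
    Set (Lp ℝ 2 (poissonLaw μ)) :=
  {F | energy μ ψ F < ∞}

/-- The cylindrical functions `γ ↦ f(γ(h_1), …, γ(h_m))`, with `f ∈ C_b^1(ℝ^m)` (bounded, `C^1`, with
bounded derivative), `h_i ∈ L^1(μ) ∩ L^∞(μ)` and `‖ψ_μ 1_{h_i ≠ 0}‖_∞ < ∞`. -/
def cylindrical (μ : Measure E) [SFinite μ] (ψ : Configuration E → E → ℝ≥0) :
    Set (Configuration E → ℝ) :=
  {F | ∃ (m : ℕ) (f : (Fin m → ℝ) → ℝ) (h : Fin m → E → ℝ),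
    1 ≤ m ∧ ContDiff ℝ 1 f ∧ (∃ C, ∀ x, |f x| ≤ C) ∧ (∃ C, ∀ x, ‖fderiv ℝ f x‖ ≤ C) ∧
    (∀ i, MemLp (h i) 1 μ ∧ MemLp (h i) ∞ μ ∧
      essSup ({z | h i z ≠ 0}.indicator (meanWeight μ ψ)) μ < ∞) ∧
    F = fun γ => f fun i => ∫ x, h i x ∂γ.1}

end BirthDeath

end PoissonSpace

/-! Everything rests on the Mecke identity: if `μ B < ∞`, the image of `π ⊗ μ|_B` under `(γ, z) ↦ γ
+ δ_z` is the measure `γ(B) π(dγ)`. It is absolutely continuous with respect to `π`. Since `μ` is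
σ-finite, adding a point therefore pulls `π`-null sets back to `(π ⊗ μ)`-null sets
(`IsPoissonMeasure.quasiMeasurePreserving_addPoint`), and `D_z F` depends only on the class of `F`.

For an event given by finitely many counts, the sets involved are cut, together with `B`, into
atoms. The counts of the atoms are independent Poisson variables, and the identity becomes the
recursion `(k+1) p(a,k+1) = a p(a,k)` in one coordinate. A π-λ argument extends it to all events.

The form is then a weighted `L²` inner product of differences. Contractions act pointwise on `|D_z
F|`, constants have zero difference, and closedness follows from Fatou's lemma along an a.e.
convergent subsequence (`energy_le_liminf`). For density, an `F` orthogonal to the domain has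
integral zero over every event given by the counts of finitely many sets of finite `(1 +
ψ_μ)μ`-measure. Indicators of such events have finite energy and the events form a generating
π-system, so `F = 0`.

For cylindrical functions, Campbell's formula makes `γ(h_i)` almost surely meaningful, and a
gradient bound on `f` reduces the energy to `∫ h_i² ψ_μ dμ`. -/

namespace PoissonSpace

/-! ### Atoms of a finite family of sets. -/

section Atoms

variable {E ι : Type*}

/-- The atoms of the algebra of sets generated by a family. -/
def atom (A : ι → Set E) (s : Set ι) : Set E := {x | ∀ i, x ∈ A i ↔ i ∈ s}

theorem disjoint_atom {A : ι → Set E} {s t : Set ι} (h : s ≠ t) :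
    Disjoint (atom A s) (atom A t) :=
  Set.disjoint_left.2 fun _ hs ht => h (Set.ext fun i => (hs i).symm.trans (ht i))

-- Only nonempty index sets occur. The atom of the empty index set is the complement of the union of
-- the family and may have infinite measure.
open Classical in
theorem biUnion_atom [Fintype ι] (A : ι → Set E) (i : ι) :
    A i = ⋃ s ∈ Finset.univ.filter fun s : {s : Set ι // s.Nonempty} => i ∈ s.1, atom A s.1 := by
  ext x
  simp only [Finset.mem_filter, Finset.mem_univ, true_and, Set.mem_iUnion, exists_prop]
  constructor
  · exact fun hx => ⟨⟨{j | x ∈ A j}, i, hx⟩, hx, fun j => Iff.rfl⟩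
  · rintro ⟨s, hi, hx⟩
    exact (hx i).2 hi

end Atoms

/-! ### The Mecke identity, Campbell's formula and quasi-invariance. -/

section Mecke

variable {E : Type*} [MeasurableSpace E]

theorem measurable_count {A : Set E} (hA : MeasurableSet A) :
    Measurable fun γ : Configuration E => γ.1 A :=
  (Measure.measurable_coe hA).comp measurable_val

theorem tsum_poissonWeight {a : ℝ} (ha : 0 ≤ a) : ∑' k, poissonWeight a k = 1 := by
  have h : HasSum (fun k : ℕ => Real.exp (-a) * a ^ k / (k.factorial : ℝ)) 1 := by
    have h := (NormedSpace.expSeries_div_hasSum_exp a).mul_left (Real.exp (-a))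
    rw [← Real.exp_eq_exp_ℝ, ← Real.exp_add, neg_add_cancel, Real.exp_zero] at h
    simpa only [mul_div_assoc] using h
  unfold poissonWeight
  rw [← ENNReal.ofReal_tsum_of_nonneg (fun k => by positivity) h.summable, h.tsum_eq,
    ENNReal.ofReal_one]

/-- This recursion is the Mecke identity for a single count, read weight by weight. -/
theorem poissonWeight_succ {a : ℝ} (ha : 0 ≤ a) (k : ℕ) :
    ((k + 1 : ℕ) : ℝ≥0∞) * poissonWeight a (k + 1) = ENNReal.ofReal a * poissonWeight a k := by
  unfold poissonWeight
  rw [← ENNReal.ofReal_natCast, ← ENNReal.ofReal_mul (by positivity),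
    ← ENNReal.ofReal_mul ha, Nat.factorial_succ, pow_succ]
  congr 1
  push_cast
  have : (k.factorial : ℝ) ≠ 0 := by positivity
  field_simp

variable {μ : Measure E} {π : Measure (Configuration E)} {ι : Type*} [Fintype ι]

theorem IsPoissonMeasure.apply_counts (hπ : IsPoissonMeasure μ π) {C : ι → Set E}
    (hC : ∀ i, MeasurableSet (C i)) (hd : Pairwise (Function.onFun Disjoint C))
    (hf : ∀ i, μ (C i) < ∞) (k : ι → ℕ) :
    π {γ | ∀ i, γ.1 (C i) = (k i : ℝ≥0∞)} = ∏ i, poissonWeight (μ (C i)).toReal (k i) := by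
  let e := (Fintype.equivFin ι).symm
  have h := hπ.apply_eq _ (C ∘ e) (fun i => hC _) (fun i j hij => hd (e.injective.ne hij))
    (fun i => hf _) (k ∘ e)
  rw [← e.prod_comp]
  refine Eq.trans ?_ h
  congr 1
  ext γ
  exact e.forall_congr_right.symm

/-- A configuration may give `C` infinite mass, but the Poisson weights sum to `1`, so finite counts
exhaust the probability. -/
theorem IsPoissonMeasure.ae_exists_nat (hπ : IsPoissonMeasure μ π) {C : Set E}
    (hC : MeasurableSet C) (hf : μ C < ∞) : ∀ᵐ γ ∂π, ∃ n : ℕ, γ.1 C = (n : ℝ≥0∞) := by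
  have := hπ.isProbabilityMeasure
  have hm : ∀ n : ℕ, MeasurableSet {γ : Configuration E | γ.1 C = (n : ℝ≥0∞)} := fun n =>
    measurable_count hC (measurableSet_singleton _)
  have he : {γ : Configuration E | ∃ n : ℕ, γ.1 C = (n : ℝ≥0∞)} = ⋃ n : ℕ, {γ | γ.1 C = (n : ℝ≥0∞)} := by
    ext; simp
  have hmu := MeasurableSet.iUnion hm
  rw [← he] at hmu
  rw [ae_iff_prob_eq_one (measurableSet_setOfPred.1 hmu), he,
    measure_iUnion (fun i j hij => Set.disjoint_left.2 fun γ h h' => hij ?_) hm,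
    ← tsum_poissonWeight (a := (μ C).toReal) ENNReal.toReal_nonneg]
  · refine tsum_congr fun n => ?_
    have := hπ.apply_counts (ι := Unit) (C := fun _ => C) (fun _ => hC)
      (fun i j hij => absurd (Subsingleton.elim i j) hij) (fun _ => hf) (fun _ => n)
    simpa using this
  · have h1 : γ.1 C = i := h
    have h2 : γ.1 C = j := h'
    exact_mod_cast h1.symm.trans h2

/-- The joint law of the counts of finitely many disjoint sets. -/
theorem IsPoissonMeasure.lintegral_counts (hπ : IsPoissonMeasure μ π) {C : ι → Set E}
    (hC : ∀ i, MeasurableSet (C i)) (hd : Pairwise (Function.onFun Disjoint C))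
    (hf : ∀ i, μ (C i) < ∞) (φ : (ι → ℝ≥0∞) → ℝ≥0∞) :
    ∫⁻ γ, φ (fun i => γ.1 (C i)) ∂π =
      ∑' k : ι → ℕ, φ (fun i => k i) * ∏ i, poissonWeight (μ (C i)).toReal (k i) := by
  have hm : ∀ k : ι → ℕ, MeasurableSet {γ : Configuration E | ∀ i, γ.1 (C i) = (k i : ℝ≥0∞)} := by
    intro k
    rw [Set.ofPred_forall]
    exact MeasurableSet.iInter fun i => measurable_count (hC i) (measurableSet_singleton _)
  have hu : ∀ᵐ γ ∂π, γ ∈ ⋃ k : ι → ℕ, {γ : Configuration E | ∀ i, γ.1 (C i) = (k i : ℝ≥0∞)} := by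
    filter_upwards [ae_all_iff.2 fun i => hπ.ae_exists_nat (hC i) (hf i)] with γ hγ
    choose k hk using hγ
    exact Set.mem_iUnion.2 ⟨k, hk⟩
  have hu' : (⋃ k : ι → ℕ, {γ : Configuration E | ∀ i, γ.1 (C i) = (k i : ℝ≥0∞)}) =ᵐ[π] Set.univ :=
    eventuallyEq_univ.2 hu
  -- Almost surely the vector of counts is one of countably many integer vectors, and the integrand
  -- is constant on each corresponding event. No measurability of `φ` is needed.
  rw [← setLIntegral_univ, ← setLIntegral_congr hu', lintegral_iUnion hm]
  · refine tsum_congr fun k => ?_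
    rw [← hπ.apply_counts hC hd hf k, ← setLIntegral_const]
    exact setLIntegral_congr_fun (hm k) fun γ hγ => by
      have : (fun i => γ.1 (C i)) = fun i => (k i : ℝ≥0∞) := funext hγ
      simp only [this]
  · refine fun k l hkl => Set.disjoint_left.2 fun γ h h' => hkl (funext fun i => ?_)
    have := (h i).symm.trans (h' i)
    exact_mod_cast this

/-- The factor `k j` in the sum over count vectors is absorbed by `poissonWeight_succ` after
shifting the `j`-th coordinate by one. -/
theorem IsPoissonMeasure.lintegral_counts_mul (hπ : IsPoissonMeasure μ π) [DecidableEq ι]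
    {C : ι → Set E} (hC : ∀ i, MeasurableSet (C i)) (hd : Pairwise (Function.onFun Disjoint C))
    (hf : ∀ i, μ (C i) < ∞) (φ : (ι → ℝ≥0∞) → ℝ≥0∞) (j : ι) :
    ∫⁻ γ, φ (fun i => γ.1 (C i)) * γ.1 (C j) ∂π =
      μ (C j) * ∫⁻ γ, φ (fun i => γ.1 (C i) + if i = j then 1 else 0) ∂π := by
  rw [hπ.lintegral_counts hC hd hf fun x => φ x * x j,
    hπ.lintegral_counts hC hd hf fun x => φ fun i => x i + if i = j then 1 else 0,
    ← ENNReal.tsum_mul_left]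
  have hinj : Function.Injective fun k : ι → ℕ => fun i => k i + if i = j then 1 else 0 := by
    intro k l h
    funext i
    have := congrFun h i
    simpa using this
  -- The shift misses exactly the vectors with `k j = 0`, whose terms vanish because of the factor
  -- `k j`.
  rw [← hinj.tsum_eq]
  · refine tsum_congr fun k => ?_
    have hw : ((k j + 1 : ℕ) : ℝ≥0∞) *
        ∏ i, poissonWeight (μ (C i)).toReal (k i + if i = j then 1 else 0) =
        μ (C j) * ∏ i, poissonWeight (μ (C i)).toReal (k i) := by
      rw [← Finset.mul_prod_erase _ _ (Finset.mem_univ j), ← mul_assoc, if_pos rfl,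
        poissonWeight_succ ENNReal.toReal_nonneg, ENNReal.ofReal_toReal (hf j).ne, mul_assoc,
        ← Finset.mul_prod_erase _ _ (Finset.mem_univ j)]
      congr 2
      exact Finset.prod_congr rfl fun i hi => by rw [if_neg (Finset.ne_of_mem_erase hi), add_zero]
    rw [mul_left_comm, ← hw]
    simp only [if_true]
    rw [mul_assoc]
    congr 2
    funext i
    push_cast
    rfl
  · intro k hk
    have hkj : k j ≠ 0 := fun h => hk (by simp [h])
    refine ⟨fun i => k i - if i = j then 1 else 0, funext fun i => ?_⟩
    by_cases hi : i = j
    · subst hi; simp; omega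
    · simp [hi]

theorem measurableSet_atom {A : ι → Set E} (hA : ∀ i, MeasurableSet (A i)) (s : Set ι) :
    MeasurableSet (atom A s) := by
  unfold atom
  rw [Set.ofPred_forall]
  refine MeasurableSet.iInter fun i => ?_
  by_cases h : i ∈ s
  · simpa [h] using hA i
  · simp only [h, iff_false]
    exact (hA i).compl

open Classical in
theorem measure_eq_sum_atom {A : ι → Set E} (hA : ∀ i, MeasurableSet (A i)) (ν : Measure E)
    (i : ι) : ν (A i) =
      ∑ s ∈ Finset.univ.filter fun s : {s : Set ι // s.Nonempty} => i ∈ s.1, ν (atom A s.1) := by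
  conv_lhs => rw [biUnion_atom A i]
  exact measure_biUnion_finset (fun s _ t _ h => disjoint_atom (Subtype.coe_injective.ne h))
    fun s _ => measurableSet_atom hA _

/-- The events that depend on the counts of finitely many measurable sets of finite `ν`-measure. -/
def countEvents (ν : Measure E) : Set (Set (Configuration E)) :=
  {S | ∃ (ι : Type) (_ : Fintype ι) (A : ι → Set E) (T : Set (ι → ℝ≥0∞)),
    (∀ i, MeasurableSet (A i)) ∧ (∀ i, ν (A i) < ∞) ∧ MeasurableSet T ∧
    S = {γ | (fun i => γ.1 (A i)) ∈ T}}

theorem isPiSystem_countEvents (ν : Measure E) : IsPiSystem (countEvents ν) := by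
  rintro _ ⟨ι, _, A, T, hA, hf, hT, rfl⟩ _ ⟨κ, _, B, U, hB, hg, hU, rfl⟩ _
  refine ⟨ι ⊕ κ, inferInstance, Sum.elim A B,
    {x | (fun i => x (Sum.inl i)) ∈ T} ∩ {x | (fun i => x (Sum.inr i)) ∈ U},
    by rintro (i | i); exacts [hA i, hB i], by rintro (i | i); exacts [hf i, hg i],
    (measurableSet_preimage (by fun_prop) hT).inter (measurableSet_preimage (by fun_prop) hU), rfl⟩

theorem measurableSet_countEvents {ν : Measure E} {S : Set (Configuration E)}
    (hS : S ∈ countEvents ν) : MeasurableSet S := by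
  obtain ⟨ι, _, A, T, hA, -, hT, rfl⟩ := hS
  exact measurableSet_preimage (measurable_pi_lambda _ fun i => measurable_count (hA i)) hT

/-- A set of infinite measure is cut along a spanning sequence, and its count is the sum of the
counts of the pieces. The measure `ν` is left free because the Mecke identity uses `μ` and the
density of the domain uses `(1 + ψ_μ)μ`. -/
theorem generateFrom_countEvents (ν : Measure E) [SigmaFinite ν] :
    instMeasurableSpaceConfiguration E = MeasurableSpace.generateFrom (countEvents ν) := by
  refine le_antisymm ?_ (MeasurableSpace.generateFrom_le fun S hS => measurableSet_countEvents hS)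
  refine Measurable.comap_le ?_
  refine @Measure.measurable_of_measurable_coe _ _ _ (_) _ fun A hA => ?_
  have hA' : A = ⋃ n, A ∩ disjointed (spanningSets ν) n := by
    rw [← Set.inter_iUnion, iUnion_disjointed, iUnion_spanningSets, Set.inter_univ]
  have hm : ∀ n, MeasurableSet (A ∩ disjointed (spanningSets ν) n) := fun n =>
    hA.inter (MeasurableSet.disjointed (measurableSet_spanningSets ν) n)
  have he : ∀ γ : Configuration E, γ.1 A = ∑' n, γ.1 (A ∩ disjointed (spanningSets ν) n) := by
    intro γ
    conv_lhs => rw [hA']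
    exact measure_iUnion (fun i j hij => ((disjoint_disjointed _ hij).mono
      Set.inter_subset_right Set.inter_subset_right)) hm
  simp_rw [he]
  refine @Measurable.tsum _ _ _ (_) _ _ _ _ _ _ _ _ _ _ _ _ fun n T hT => ?_
  refine MeasurableSpace.measurableSet_generateFrom
    ⟨Unit, inferInstance, fun _ => A ∩ disjointed (spanningSets ν) n, {x | x () ∈ T},
      fun _ => hm n, fun _ => ?_, measurableSet_preimage (by fun_prop) hT, rfl⟩
  exact (measure_mono (Set.inter_subset_right.trans (disjointed_subset _ _))).trans_lt
    (measure_spanningSets_lt_top ν n)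

/-- The Mecke identity on events that depend on finitely many counts. -/
theorem IsPoissonMeasure.mecke_countEvents (hπ : IsPoissonMeasure μ π) {B : Set E}
    (hB : MeasurableSet B) (hBf : μ B < ∞) {S : Set (Configuration E)} (hS : S ∈ countEvents μ) :
    ∫⁻ z in B, π {γ | addPoint γ z ∈ S} ∂μ = ∫⁻ γ in S, γ.1 B ∂π := by
  classical
  have hSm := measurableSet_countEvents hS
  obtain ⟨κ, _, A', T', hA', hf', hT', hSe⟩ := hS
  -- `B` joins the family under the index `none`, so that it too becomes a disjoint union of atoms.
  obtain ⟨A, hAn, hAs⟩ : ∃ A : Option κ → Set E, A none = B ∧ ∀ i, A (some i) = A' i :=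
    ⟨fun o => o.elim B A', rfl, fun _ => rfl⟩
  have hA : ∀ i, MeasurableSet (A i) := by
    rintro (_ | i)
    exacts [hAn ▸ hB, hAs i ▸ hA' i]
  have hf : ∀ i, μ (A i) < ∞ := by
    rintro (_ | i)
    exacts [hAn ▸ hBf, hAs i ▸ hf' i]
  have hSA : S = {γ | (fun i => γ.1 (A (some i))) ∈ T'} := by simp_rw [hSe, hAs]
  let C (s : {s : Set (Option κ) // s.Nonempty}) : Set E := atom A s.1
  have hC : ∀ s, MeasurableSet (C s) := fun s => measurableSet_atom hA _
  have hd : Pairwise (Function.onFun Disjoint C) := fun s t h =>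
    disjoint_atom (Subtype.coe_injective.ne h)
  have hCf : ∀ s, μ (C s) < ∞ := fun s => by
    obtain ⟨i, hi⟩ := s.2
    exact (measure_mono fun x hx => (hx i).2 hi).trans_lt (hf i)
  -- `φ` expresses the indicator of `S` through the counts of the disjoint atoms.
  let φ (x : {s : Set (Option κ) // s.Nonempty} → ℝ≥0∞) : ℝ≥0∞ :=
    T'.indicator 1 fun i => ∑ s ∈ Finset.univ.filter fun s : {s : Set (Option κ) // s.Nonempty} =>
      some i ∈ s.1, x s
  have hφ : ∀ γ : Configuration E, S.indicator 1 γ = φ fun s => γ.1 (C s) := by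
    intro γ
    simp only [φ, C, ← measure_eq_sum_atom hA γ.1, hSA]
    rfl
  -- A point added in `C s` raises the count of that atom by one and leaves the others unchanged, so
  -- the probability is constant in `z ∈ C s`.
  have hφ' : ∀ s, ∀ z ∈ C s, π {γ | addPoint γ z ∈ S} =
      ∫⁻ γ, φ (fun t => γ.1 (C t) + if t = s then 1 else 0) ∂π := by
    intro s z hz
    have hm : MeasurableSet {γ | addPoint γ z ∈ S} :=
      (measurable_addPoint.comp measurable_prodMk_right) hSm
    rw [← lintegral_indicator_one hm]
    refine lintegral_congr fun γ => ?_
    refine (hφ (addPoint γ z)).trans (congrArg φ (funext fun t => ?_))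
    simp only [addPoint, Measure.add_apply, Measure.dirac_apply' z (hC t)]
    congr 1
    split_ifs with h
    · rw [h, Set.indicator_of_mem hz]; rfl
    · exact Set.indicator_of_notMem (fun h' => Set.disjoint_left.1 (hd h) h' hz) _
  have hBC := biUnion_atom A none
  rw [hAn] at hBC
  have hBs := fun γ : Configuration E => measure_eq_sum_atom hA γ.1 none
  simp only [hAn] at hBs
  rw [hBC, lintegral_biUnion_finset (fun s _ t _ h => hd h) (fun s _ => hC s), ← hBC,
    ← lintegral_indicator hSm]
  have e1 : ∀ s, ∫⁻ z in C s, π {γ | addPoint γ z ∈ S} ∂μ =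
      ∫⁻ γ, φ (fun i => γ.1 (C i)) * γ.1 (C s) ∂π := by
    intro s
    rw [hπ.lintegral_counts_mul hC hd hCf, setLIntegral_congr_fun (hC s) (hφ' s),
      setLIntegral_const, mul_comm]
  rw [Finset.sum_congr rfl fun s _ => e1 s, ← lintegral_finsetSum']
  · refine lintegral_congr fun γ => ?_
    rw [← Finset.mul_sum, ← hφ, ← hBs, ← Set.indicator_mul_left S (1 : Configuration E → ℝ≥0∞) fun γ => γ.1 B]
    simp only [Pi.one_apply, one_mul]
  · intro s _
    simp_rw [← hφ]
    exact ((measurable_one.indicator hSm).mul (measurable_count (hC s))).aemeasurable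

/-- The Mecke identity, localized to a set of finite measure. -/
theorem IsPoissonMeasure.map_addPoint (hπ : IsPoissonMeasure μ π) [SigmaFinite μ] {B : Set E}
    (hB : MeasurableSet B) (hBf : μ B < ∞) :
    (π.prod (μ.restrict B)).map (fun p => addPoint p.1 p.2) =
      π.withDensity fun γ => γ.1 B := by
  have := hπ.isProbabilityMeasure
  have : IsFiniteMeasure (μ.restrict B) := ⟨by simpa using hBf⟩
  have h : ∀ S ∈ countEvents μ, (π.prod (μ.restrict B)).map (fun p => addPoint p.1 p.2) S =
      (π.withDensity fun γ => γ.1 B) S := by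
    intro S hS
    have hSm := measurableSet_countEvents hS
    rw [Measure.map_apply measurable_addPoint hSm, withDensity_apply _ hSm,
      Measure.prod_apply_symm (measurable_addPoint hSm), ← hπ.mecke_countEvents hB hBf hS]
    rfl
  -- The whole space is the count event of the empty family, so `h` also gives equality of the total
  -- masses.
  exact ext_of_generate_finite _ (generateFrom_countEvents μ) (isPiSystem_countEvents μ) h
    (h _ ⟨Empty, inferInstance, Empty.elim, Set.univ, fun i => i.elim, fun i => i.elim,
      MeasurableSet.univ, by simp⟩)

/-- This compares total masses in the localized Mecke identity. -/
theorem IsPoissonMeasure.lintegral_count_of_lt_top (hπ : IsPoissonMeasure μ π) [SigmaFinite μ]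
    {B : Set E} (hB : MeasurableSet B) (hBf : μ B < ∞) : ∫⁻ γ, γ.1 B ∂π = μ B := by
  have := hπ.isProbabilityMeasure
  have h := DFunLike.congr_fun (hπ.map_addPoint hB hBf) Set.univ
  rw [withDensity_apply _ MeasurableSet.univ, setLIntegral_univ] at h
  rw [← h, Measure.map_apply measurable_addPoint MeasurableSet.univ, Set.preimage_univ,
    ← Set.univ_prod_univ, Measure.prod_prod, measure_univ, one_mul, Measure.restrict_apply_univ]

/-- Campbell's formula: the intensity measure of the Poisson measure is `μ`. -/
theorem IsPoissonMeasure.bind_val (hπ : IsPoissonMeasure μ π) [SigmaFinite μ] :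
    π.bind (fun γ => γ.1) = μ := by
  refine Measure.ext fun A hA => ?_
  rw [Measure.bind_apply hA measurable_val.aemeasurable]
  have hm : ∀ n, MeasurableSet (A ∩ disjointed (spanningSets μ) n) := fun n =>
    hA.inter (MeasurableSet.disjointed (measurableSet_spanningSets μ) n)
  have he : ∀ ν : Measure E, ν A = ∑' n, ν (A ∩ disjointed (spanningSets μ) n) := by
    intro ν
    rw [← measure_iUnion (fun i j hij => ((disjoint_disjointed _ hij).mono
      Set.inter_subset_right Set.inter_subset_right)) hm, ← Set.inter_iUnion, iUnion_disjointed,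
      iUnion_spanningSets, Set.inter_univ]
  rw [he μ, lintegral_congr fun γ : Configuration E => he γ.1,
    lintegral_tsum fun n => (measurable_count (hm n)).aemeasurable]
  exact tsum_congr fun n => hπ.lintegral_count_of_lt_top (hm n)
    ((measure_mono (Set.inter_subset_right.trans (disjointed_subset _ _))).trans_lt
      (measure_spanningSets_lt_top μ n))

/-- Over each `B` of finite measure the image measure has density `γ(B)` with respect to `π`. A
property that holds a.e. on every such `B` holds a.e., since `μ` is σ-finite. -/
theorem IsPoissonMeasure.quasiMeasurePreserving_addPoint (hπ : IsPoissonMeasure μ π)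
    [SigmaFinite μ] :
    Measure.QuasiMeasurePreserving (fun p : Configuration E × E => addPoint p.1 p.2)
      (π.prod μ) π := by
  have := hπ.isProbabilityMeasure
  refine ⟨measurable_addPoint, Measure.AbsolutelyContinuous.mk fun S hS h0 => ?_⟩
  rw [Measure.map_apply measurable_addPoint hS]
  have hm := measurable_addPoint hS
  rw [Measure.prod_apply_symm hm, lintegral_eq_zero_iff (measurable_measure_prodMk_right hm)]
  refine ae_of_forall_measure_lt_top_ae_restrict _ fun B hB hBf => ?_
  have h : (π.prod (μ.restrict B)) ((fun p => addPoint p.1 p.2) ⁻¹' S) = 0 := by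
    rw [← Measure.map_apply measurable_addPoint hS, hπ.map_addPoint hB hBf,
      withDensity_apply _ hS, setLIntegral_measure_zero _ _ h0]
  rwa [Measure.prod_apply_symm hm,
    lintegral_eq_zero_iff (measurable_measure_prodMk_right hm)] at h

end Mecke

/-! ### The energy as a weighted square integral of differences. -/

section Energy

variable {E : Type*} [MeasurableSpace E] {μ : Measure E} [SigmaFinite μ]
  {ψ : Configuration E → E → ℝ≥0} {F F' G G' : Configuration E → ℝ}

theorem quasiMeasurePreserving_addPoint (μ : Measure E) [SigmaFinite μ] :
    Measure.QuasiMeasurePreserving (fun p : Configuration E × E => addPoint p.1 p.2)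
      ((poissonLaw μ).prod μ) (poissonLaw μ) :=
  (isPoissonMeasure_poissonLaw μ).quasiMeasurePreserving_addPoint

/-- Quasi-invariance controls the term at `γ + δ_z`; the term at `γ` only needs the first
projection. -/
theorem difference_congr (h : F =ᵐ[poissonLaw μ] F') :
    difference F =ᵐ[(poissonLaw μ).prod μ] difference F' := by
  filter_upwards [(quasiMeasurePreserving_addPoint μ).ae h,
    Measure.quasiMeasurePreserving_fst.ae h] with p h₁ h₂
  simp only [difference, h₁, h₂]

theorem energy_congr (h : F =ᵐ[poissonLaw μ] F') : energy μ ψ F = energy μ ψ F' :=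
  lintegral_congr_ae (by filter_upwards [difference_congr h] with p hp; rw [hp])

theorem form_congr (hF : F =ᵐ[poissonLaw μ] F') (hG : G =ᵐ[poissonLaw μ] G') :
    form μ ψ F G = form μ ψ F' G' :=
  integral_congr_ae (by
    filter_upwards [difference_congr hF, difference_congr hG] with p h₁ h₂; rw [h₁, h₂])

theorem aestronglyMeasurable_difference (hF : AEStronglyMeasurable F (poissonLaw μ)) :
    AEStronglyMeasurable (difference F) ((poissonLaw μ).prod μ) :=
  (hF.comp_quasiMeasurePreserving (quasiMeasurePreserving_addPoint μ)).sub
    (hF.comp_quasiMeasurePreserving Measure.quasiMeasurePreserving_fst)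

theorem aemeasurable_energy_integrand (hψ : Measurable (Function.uncurry ψ))
    (hF : AEStronglyMeasurable F (poissonLaw μ)) :
    AEMeasurable (fun p : Configuration E × E => ENNReal.ofReal (difference F p ^ 2) * ψ p.1 p.2)
      ((poissonLaw μ).prod μ) :=
  ((aestronglyMeasurable_difference hF).aemeasurable.pow_const 2).ennreal_ofReal.mul
    hψ.coe_nnreal_ennreal.aemeasurable

theorem aestronglyMeasurable_form_integrand (hψ : Measurable (Function.uncurry ψ))
    (hF : AEStronglyMeasurable F (poissonLaw μ)) (hG : AEStronglyMeasurable G (poissonLaw μ)) :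
    AEStronglyMeasurable
      (fun p : Configuration E × E => difference F p * difference G p * ψ p.1 p.2)
      ((poissonLaw μ).prod μ) :=
  ((aestronglyMeasurable_difference hF).mul (aestronglyMeasurable_difference hG)).mul
    hψ.coe_nnreal_real.aestronglyMeasurable

/-- Infinite energy is included: the integral of a non-integrable function and `∞.toReal` are both
`0`. -/
theorem form_self (hψ : Measurable (Function.uncurry ψ))
    (hF : AEStronglyMeasurable F (poissonLaw μ)) : form μ ψ F F = (energy μ ψ F).toReal := by
  unfold form energy
  rw [integral_eq_lintegral_of_nonneg_ae (.of_forall fun p =>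
    mul_nonneg (mul_self_nonneg _) (NNReal.coe_nonneg _))
    (aestronglyMeasurable_form_integrand hψ hF hF)]
  congr 1
  refine lintegral_congr fun p => ?_
  rw [ENNReal.ofReal_mul (mul_self_nonneg _), ENNReal.ofReal_coe_nnreal, sq]

/-- The integrand is dominated through `|ab| ≤ a² + b²`. -/
theorem integrable_form_integrand (hψ : Measurable (Function.uncurry ψ))
    (hF : AEStronglyMeasurable F (poissonLaw μ)) (hG : AEStronglyMeasurable G (poissonLaw μ))
    (hF' : energy μ ψ F < ∞) (hG' : energy μ ψ G < ∞) :
    Integrable (fun p : Configuration E × E => difference F p * difference G p * ψ p.1 p.2)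
      ((poissonLaw μ).prod μ) := by
  refine ⟨aestronglyMeasurable_form_integrand hψ hF hG, ?_⟩
  refine lt_of_le_of_lt (lintegral_mono fun p => ?_)
    ((lintegral_add_left' (aemeasurable_energy_integrand hψ hF) _).trans_lt
      (ENNReal.add_lt_top.2 ⟨hF', hG'⟩))
  rw [← add_mul, ← ENNReal.ofReal_add (sq_nonneg _) (sq_nonneg _), Real.enorm_eq_ofReal_abs,
    abs_mul, NNReal.abs_eq, ENNReal.ofReal_mul (abs_nonneg _), ENNReal.ofReal_coe_nnreal]
  gcongr
  rw [abs_mul, ← sq_abs (difference F p), ← sq_abs (difference G p)]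
  nlinarith [sq_nonneg (|difference F p| - |difference G p|),
    sq_nonneg (|difference F p| + |difference G p|)]

theorem energy_add_lt_top (hψ : Measurable (Function.uncurry ψ))
    (hF : AEStronglyMeasurable F (poissonLaw μ)) (hF' : energy μ ψ F < ∞)
    (hG' : energy μ ψ G < ∞) : energy μ ψ (F + G) < ∞ := by
  have h : energy μ ψ (F + G) ≤ 2 * (energy μ ψ F + energy μ ψ G) := by
    unfold energy
    rw [← lintegral_add_left' (aemeasurable_energy_integrand hψ hF),
      ← lintegral_const_mul' _ _ (by simp)]
    refine lintegral_mono fun p => ?_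
    rw [← add_mul, ← mul_assoc, ← ENNReal.ofReal_add (sq_nonneg _) (sq_nonneg _),
      ← ENNReal.ofReal_ofNat, ← ENNReal.ofReal_mul (by norm_num)]
    gcongr
    have : difference (F + G) p = difference F p + difference G p := by
      simp only [difference, Pi.add_apply]; ring
    rw [this]
    nlinarith [sq_nonneg (difference F p - difference G p)]
  exact h.trans_lt (ENNReal.mul_lt_top (by simp) (ENNReal.add_lt_top.2 ⟨hF', hG'⟩))

theorem energy_smul (c : ℝ) (F : Configuration E → ℝ) :
    energy μ ψ (c • F) = ENNReal.ofReal (c ^ 2) * energy μ ψ F := by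
  unfold energy
  rw [← lintegral_const_mul' _ _ ENNReal.ofReal_ne_top]
  refine lintegral_congr fun p => ?_
  rw [← mul_assoc, ← ENNReal.ofReal_mul (sq_nonneg _), ← mul_pow]
  simp only [difference, Pi.smul_apply, smul_eq_mul, mul_sub]

/-- Every normal contraction operates on the energy. -/
theorem energy_comp_le {φ : ℝ → ℝ} (hφ : LipschitzWith 1 φ) (F : Configuration E → ℝ) :
    energy μ ψ (φ ∘ F) ≤ energy μ ψ F := by
  refine lintegral_mono fun p => ?_
  gcongr ENNReal.ofReal ?_ * _
  rw [sq_le_sq]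
  simpa [Real.dist_eq, difference] using hφ.dist_le_mul (F (addPoint p.1 p.2)) (F p.1)

/-- Lower semicontinuity of the energy under almost sure convergence. -/
theorem energy_le_liminf (hψ : Measurable (Function.uncurry ψ)) {F : ℕ → Configuration E → ℝ}
    (hF : ∀ n, AEStronglyMeasurable (F n) (poissonLaw μ))
    (h : ∀ᵐ γ ∂(poissonLaw μ), Tendsto (fun n => F n γ) atTop (𝓝 (G γ))) :
    energy μ ψ G ≤ liminf (fun n => energy μ ψ (F n)) atTop := by
  refine le_trans (le_of_eq ?_)
    (lintegral_liminf_le' fun n => aemeasurable_energy_integrand hψ (hF n))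
  refine lintegral_congr_ae ?_
  -- By quasi-invariance the convergence holds at `γ + δ_z` as well as at `γ`, so the differences
  -- converge a.e. and Fatou's lemma applies.
  filter_upwards [(quasiMeasurePreserving_addPoint μ).ae h,
    Measure.quasiMeasurePreserving_fst.ae h] with p h₁ h₂
  refine (Tendsto.liminf_eq ?_).symm
  exact ENNReal.Tendsto.mul_const (ENNReal.tendsto_ofReal ((h₁.sub h₂).pow 2))
    (Or.inr ENNReal.coe_ne_top)

/-- By Tonelli, integrating out `γ` first turns `ψ` into `ψ_μ`. -/
theorem lintegral_snd_mul_weight (hψ : Measurable (Function.uncurry ψ)) {g : E → ℝ≥0∞}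
    (hg : AEMeasurable g μ) :
    ∫⁻ p : Configuration E × E, g p.2 * ψ p.1 p.2 ∂((poissonLaw μ).prod μ) =
      ∫⁻ z, g z * meanWeight μ ψ z ∂μ := by
  have hψ' := hψ.coe_nnreal_ennreal
  have hm : AEMeasurable (fun p : Configuration E × E => g p.2 * ψ p.1 p.2)
      ((poissonLaw μ).prod μ) :=
    (hg.comp_quasiMeasurePreserving Measure.quasiMeasurePreserving_snd).mul hψ'.aemeasurable
  rw [lintegral_prod_symm _ hm]
  refine lintegral_congr fun z => ?_
  have hz : Measurable fun γ => (ψ γ z : ℝ≥0∞) := hψ'.comp measurable_prodMk_right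
  simp only [meanWeight]
  exact lintegral_const_mul (g z) hz

theorem measurable_meanWeight (hψ : Measurable (Function.uncurry ψ)) :
    Measurable (meanWeight μ ψ) :=
  hψ.coe_nnreal_ennreal.lintegral_prod_left'

/-- Adding `z` can change membership in `S` only if `z` lies in some `A i`, and the squared
difference is at most `1`. The energy is thus bounded by the integral of `ψ_μ` over the union of the
`A i`. -/
theorem energy_indicator_lt_top (hψ : Measurable (Function.uncurry ψ))
    {S : Set (Configuration E)}
    (hS : S ∈ countEvents (μ.withDensity fun z => 1 + meanWeight μ ψ z)) :
    energy μ ψ (S.indicator fun _ => 1) < ∞ := by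
  obtain ⟨ι, _, A, T, hA, hf, -, rfl⟩ := hS
  have hU : MeasurableSet (⋃ i, A i) := MeasurableSet.iUnion hA
  set S := {γ : Configuration E | (fun i => γ.1 (A i)) ∈ T} with hS
  have h1 : energy μ ψ (S.indicator fun _ => 1) ≤
      ∫⁻ z, (⋃ i, A i).indicator 1 z * meanWeight μ ψ z ∂μ := by
    rw [← lintegral_snd_mul_weight hψ (measurable_one.indicator hU).aemeasurable]
    refine lintegral_mono fun p => ?_
    gcongr
    by_cases hz : p.2 ∈ ⋃ i, A i
    · rw [Set.indicator_of_mem hz, Pi.one_apply]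
      refine ENNReal.ofReal_le_one.2 ?_
      unfold difference
      by_cases h : addPoint p.1 p.2 ∈ S <;> by_cases h' : p.1 ∈ S <;> simp [h, h']
    · have : addPoint p.1 p.2 ∈ S ↔ p.1 ∈ S := by
        have he : ∀ i, (addPoint p.1 p.2).1 (A i) = p.1.1 (A i) := fun i => by
          simp only [addPoint, Measure.add_apply, Measure.dirac_apply' _ (hA i)]
          rw [Set.indicator_of_notMem fun h => hz (Set.mem_iUnion.2 ⟨i, h⟩), add_zero]
        simp only [hS, Set.mem_ofPred_eq, he]
      by_cases h' : p.1 ∈ S <;> simp [difference, this, h']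
  refine h1.trans_lt (lt_of_le_of_lt ?_
    ((measure_iUnion_fintype_le (μ.withDensity fun z => 1 + meanWeight μ ψ z) A).trans_lt
      (ENNReal.sum_lt_top.2 fun i _ => hf i)))
  rw [withDensity_apply _ hU, ← lintegral_indicator hU]
  refine lintegral_mono fun z => ?_
  by_cases hz : z ∈ ⋃ i, A i
  · simp [Set.indicator_of_mem hz]
  · simp [Set.indicator_of_notMem hz]

end Energy

/-! ### Integrals against a random configuration. -/

section Campbell

variable {E : Type*} [MeasurableSpace E] {μ : Measure E} [SigmaFinite μ]
  {π : Measure (Configuration E)}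

/-- By Campbell's formula, almost no configuration charges a given `μ`-null set. Hence `γ(h)` is
almost surely independent of the version of `h`. -/
theorem IsPoissonMeasure.ae_ae (hπ : IsPoissonMeasure μ π) {p : E → Prop} (h : ∀ᵐ x ∂μ, p x) :
    ∀ᵐ γ ∂π, ∀ᵐ x ∂γ.1, p x := by
  rw [← hπ.bind_val] at h
  exact Measure.ae_ae_of_ae_bind measurable_val.aemeasurable h

theorem IsPoissonMeasure.ae_integrable (hπ : IsPoissonMeasure μ π) {h : E → ℝ}
    (hh : Integrable h μ) : ∀ᵐ γ ∂π, Integrable h γ.1 := by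
  -- Campbell's formula for `|h|`: the mean of `γ(|h|)` is the `L¹(μ)` norm of `h`.
  have h1 : ∫⁻ γ, ∫⁻ x, ‖h x‖ₑ ∂γ.1 ∂π ≠ ∞ := by
    have e := Measure.lintegral_bind (m := π) (μ := fun γ => γ.1) (f := fun x => ‖h x‖ₑ)
      measurable_val.aemeasurable (by rw [hπ.bind_val]; exact hh.1.enorm)
    rw [← e, hπ.bind_val]
    exact hh.2.ne
  have hk := hh.1.ae_eq_mk
  have h2 : ∀ᵐ γ ∂π, ∫⁻ x, ‖hh.1.mk h x‖ₑ ∂γ.1 < ∞ := by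
    refine ae_lt_top ((Measure.measurable_lintegral
      hh.1.stronglyMeasurable_mk.measurable.enorm).comp measurable_val) ?_
    refine ne_of_eq_of_ne (lintegral_congr_ae ?_) h1
    filter_upwards [hπ.ae_ae hk] with γ hγ
    exact lintegral_congr_ae (by filter_upwards [hγ] with x hx; rw [hx])
  filter_upwards [hπ.ae_ae hk, h2] with γ h₁ h₂
  exact Integrable.congr ⟨hh.1.stronglyMeasurable_mk.aestronglyMeasurable, h₂⟩ (EventuallyEq.symm h₁)

/-- For a measurable version of `h`, the lower integrals of its positive and negative parts are
measurable in every `γ`. Their difference is `γ(h)` whenever `h` is integrable, which is almost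
surely the case. -/
theorem IsPoissonMeasure.aemeasurable_integral (hπ : IsPoissonMeasure μ π) {h : E → ℝ}
    (hh : Integrable h μ) : AEMeasurable (fun γ : Configuration E => ∫ x, h x ∂γ.1) π := by
  have hm := hh.1.stronglyMeasurable_mk.measurable
  refine ⟨fun γ => (∫⁻ x, ENNReal.ofReal (hh.1.mk h x) ∂γ.1).toReal -
    (∫⁻ x, ENNReal.ofReal (-hh.1.mk h x) ∂γ.1).toReal,
    ((Measure.measurable_lintegral hm.ennreal_ofReal).comp measurable_val).ennreal_toReal.sub
    ((Measure.measurable_lintegral hm.neg.ennreal_ofReal).comp measurable_val).ennreal_toReal, ?_⟩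
  filter_upwards [hπ.ae_ae hh.1.ae_eq_mk, hπ.ae_integrable hh] with γ h₁ h₂
  rw [integral_congr_ae h₁, integral_eq_lintegral_pos_part_sub_lintegral_neg_part (h₂.congr h₁)]

end Campbell

/-! ### Cylindrical functions have finite energy. -/

section Cylindrical

variable {E : Type*} [MeasurableSpace E] {μ : Measure E} [SigmaFinite μ]
  {ψ : Configuration E → E → ℝ≥0} {F : Configuration E → ℝ}

theorem memLp_of_mem_cylindrical (hF : F ∈ cylindrical μ ψ) : MemLp F 2 (poissonLaw μ) := by
  obtain ⟨m, f, h, -, hf, ⟨C, hC⟩, -, hh, rfl⟩ := hF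
  refine MemLp.of_bound (C := C) ?_ (.of_forall fun γ => hC _)
  have : AEMeasurable (fun (γ : Configuration E) i => ∫ x, h i x ∂γ.1) (poissonLaw μ) :=
    aemeasurable_pi_lambda _ fun i => (isPoissonMeasure_poissonLaw μ).aemeasurable_integral
      (memLp_one_iff_integrable.1 (hh i).1)
  exact (hf.continuous.measurable.comp_aemeasurable this).aestronglyMeasurable

/-- With `K` the sup norm of `h` and `M` the bound on `ψ_μ` where `h ≠ 0`, one has `h² ψ_μ ≤ K M
|h|` a.e., and `h` is in `L¹`. -/
theorem lintegral_sq_mul_meanWeight_lt_top {h : E → ℝ} (h1 : MemLp h 1 μ) (h2 : MemLp h ∞ μ)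
    (hs : essSup ({z | h z ≠ 0}.indicator (meanWeight μ ψ)) μ < ∞) :
    ∫⁻ z, ENNReal.ofReal (h z ^ 2) * meanWeight μ ψ z ∂μ < ∞ := by
  have hK : eLpNorm h ∞ μ < ∞ := h2.2
  set K := eLpNorm h ∞ μ
  set M := essSup ({z | h z ≠ 0}.indicator (meanWeight μ ψ)) μ
  refine lt_of_le_of_lt (lintegral_mono_ae (g := fun z => K * M * ‖h z‖ₑ) ?_) ?_
  · filter_upwards [ae_le_eLpNormEssSup (f := h) (μ := μ),
      ENNReal.ae_le_essSup (μ := μ) ({z | h z ≠ 0}.indicator (meanWeight μ ψ))] with z hz hz'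
    by_cases h0 : h z = 0
    · simp [h0]
    · rw [Set.indicator_of_mem h0] at hz'
      rw [← sq_abs, ENNReal.ofReal_pow (abs_nonneg _), ← Real.enorm_eq_ofReal_abs, sq]
      calc ‖h z‖ₑ * ‖h z‖ₑ * meanWeight μ ψ z ≤ K * ‖h z‖ₑ * M := by
            gcongr
            exact hz.trans_eq eLpNorm_exponent_top.symm
        _ = K * M * ‖h z‖ₑ := by ring
  · rw [lintegral_const_mul' _ _ (ENNReal.mul_lt_top hK hs).ne]
    exact ENNReal.mul_lt_top (ENNReal.mul_lt_top hK hs) (memLp_one_iff_integrable.1 h1).2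

/-- The mean value inequality gives `|D_z F| ≤ C ‖(h_i(z))_i‖` for almost every `(γ, z)`, and the
right side no longer depends on `γ`. -/
theorem energy_lt_top_of_mem_cylindrical [MeasurableSingletonClass E]
    (hψ : Measurable (Function.uncurry ψ))
    (hF : F ∈ cylindrical μ ψ) : energy μ ψ F < ∞ := by
  obtain ⟨m, f, h, -, hf, -, ⟨C, hC⟩, hh, rfl⟩ := hF
  have hm : ∀ i, AEMeasurable (fun z => ENNReal.ofReal (h i z ^ 2)) μ := fun i =>
    ((hh i).1.1.aemeasurable.pow_const 2).ennreal_ofReal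
  have hfC : ∀ x y, |f x - f y| ≤ C * ‖x - y‖ := fun x y =>
    convex_univ.norm_image_sub_le_of_norm_fderiv_le
      (fun x _ => (hf.differentiable one_ne_zero).differentiableAt) (fun x _ => hC x)
      (Set.mem_univ y) (Set.mem_univ x)
  have hi : ∀ᵐ p ∂((poissonLaw μ).prod μ), ∀ i, Integrable (h i) p.1.1 :=
    Measure.quasiMeasurePreserving_fst.ae (ae_all_iff.2 fun i =>
      (isPoissonMeasure_poissonLaw μ).ae_integrable (memLp_one_iff_integrable.1 (hh i).1))
  have hle : energy μ ψ (fun γ => f fun i => ∫ x, h i x ∂γ.1) ≤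
      ∫⁻ z, (ENNReal.ofReal (C ^ 2) * ∑ i, ENNReal.ofReal (h i z ^ 2)) * meanWeight μ ψ z ∂μ := by
    rw [← lintegral_snd_mul_weight hψ ((Finset.aemeasurable_fun_sum _ fun i _ => hm i).const_mul _)]
    refine lintegral_mono_ae ?_
    filter_upwards [hi] with p hp
    gcongr
    -- Additivity needs `h i` integrable under `γ`, which holds almost surely. Measurable singletons
    -- let `δ_z` integrate `h i` without its being Borel.
    have hd : ∀ i, ∫ x, h i x ∂(addPoint p.1 p.2).1 = ∫ x, h i x ∂p.1.1 + h i p.2 := fun i => by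
      simp only [addPoint]
      rw [integral_add_measure (hp i) (integrable_dirac (by simp)), integral_dirac]
    rw [← ENNReal.ofReal_sum_of_nonneg fun i _ => sq_nonneg _,
      ← ENNReal.ofReal_mul (sq_nonneg _)]
    refine ENNReal.ofReal_le_ofReal ?_
    have h1 : |difference (fun γ : Configuration E => f fun i => ∫ x, h i x ∂γ.1) p| ≤
        C * ‖fun i => h i p.2‖ := by
      refine (hfC _ _).trans_eq ?_
      congr 2
      funext i
      simp [hd]
    rw [← sq_abs]
    refine (pow_le_pow_left₀ (abs_nonneg _) h1 2).trans ?_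
    rw [mul_pow]
    gcongr
    -- The norm on `Fin m → ℝ` is the sup norm, which the Euclidean norm dominates.
    have hn : ‖fun i => h i p.2‖ ≤ Real.sqrt (∑ i, h i p.2 ^ 2) :=
      (pi_norm_le_iff_of_nonneg (Real.sqrt_nonneg _)).2 fun i => Real.abs_le_sqrt
        (Finset.single_le_sum (f := fun i => h i p.2 ^ 2) (fun i _ => sq_nonneg _)
          (Finset.mem_univ i))
    exact (Real.le_sqrt (norm_nonneg _) (Finset.sum_nonneg fun i _ => sq_nonneg _)).1 hn
  refine hle.trans_lt ?_
  simp_rw [mul_assoc, Finset.sum_mul]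
  have hm' : ∀ i, AEMeasurable (fun z => ENNReal.ofReal (h i z ^ 2) * meanWeight μ ψ z) μ :=
    fun i => (hm i).mul (measurable_meanWeight hψ).aemeasurable
  rw [lintegral_const_mul' _ _ ENNReal.ofReal_ne_top, lintegral_finsetSum' _ fun i _ => hm' i]
  exact ENNReal.mul_lt_top ENNReal.ofReal_lt_top (ENNReal.sum_lt_top.2 fun i _ =>
    lintegral_sq_mul_meanWeight_lt_top (hh i).1 (hh i).2.1 (hh i).2.2)

end Cylindrical

/-! ### The Dirichlet form properties and conservativeness. -/

section Domain

variable {E : Type*} [MeasurableSpace E] {μ : Measure E} [SigmaFinite μ]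
  {ψ : Configuration E → E → ℝ≥0}

theorem add_mem_domain (hψ : Measurable (Function.uncurry ψ)) {u v : Lp ℝ 2 (poissonLaw μ)}
    (hu : u ∈ domain μ ψ) (hv : v ∈ domain μ ψ) : u + v ∈ domain μ ψ :=
  (energy_congr (Lp.coeFn_add u v)).trans_lt
    (energy_add_lt_top hψ (Lp.aestronglyMeasurable u) hu hv)

theorem smul_mem_domain (c : ℝ) {u : Lp ℝ 2 (poissonLaw μ)} (hu : u ∈ domain μ ψ) :
    c • u ∈ domain μ ψ := by
  refine (energy_congr (Lp.coeFn_smul c u)).trans_lt ?_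
  rw [energy_smul]
  exact ENNReal.mul_lt_top ENNReal.ofReal_lt_top hu

theorem difference_const (c : ℝ) : difference (Function.const (Configuration E) c) = 0 := by
  funext p; simp [difference]

theorem energy_const (c : ℝ) : energy μ ψ (Function.const _ c) = 0 := by
  simp [energy, difference_const]

theorem form_const_left (c : ℝ) (G : Configuration E → ℝ) :
    form μ ψ (Function.const _ c) G = 0 := by
  simp [form, difference_const]

theorem const_mem_domain (c : ℝ) : Lp.const 2 (poissonLaw μ) c ∈ domain μ ψ := by
  change energy μ ψ _ < ∞
  rw [energy_congr (Lp.coeFn_const ..), energy_const]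
  exact ENNReal.zero_lt_top

/-- The domain as a linear subspace. -/
def domainSubmodule (μ : Measure E) [SigmaFinite μ] (hψ : Measurable (Function.uncurry ψ)) :
    Submodule ℝ (Lp ℝ 2 (poissonLaw μ)) where
  carrier := domain μ ψ
  add_mem' hu hv := add_mem_domain hψ hu hv
  zero_mem' := by
    change energy μ ψ _ < ∞
    rw [energy_congr (F' := Function.const _ 0) (Lp.coeFn_zero ..), energy_const]
    exact ENNReal.zero_lt_top
  smul_mem' c _ hu := smul_mem_domain c hu

/-- The orthogonal complement is trivial: an orthogonal `F` integrates to zero over a π-system of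
events with indicators in the domain, hence over every event. -/
theorem dense_domain (hψ : Measurable (Function.uncurry ψ))
    (hψμ : ∀ᵐ z ∂μ, meanWeight μ ψ z < ∞) : Dense (domain μ ψ) := by
  change Dense (domainSubmodule μ hψ : Set (Lp ℝ 2 (poissonLaw μ)))
  rw [Submodule.dense_iff_topologicalClosure_eq_top, Submodule.topologicalClosure_eq_top_iff,
    Submodule.eq_bot_iff]
  intro F hF
  have hint : Integrable F (poissonLaw μ) := (Lp.memLp F).integrable one_le_two
  -- The a.e. finiteness of `ψ_μ` enters here: it makes `(1 + ψ_μ)μ` σ-finite, so its count events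
  -- still generate the σ-field.
  have hν : SigmaFinite (μ.withDensity fun z => 1 + meanWeight μ ψ z) :=
    SigmaFinite.withDensity_of_ne_top (by
      filter_upwards [hψμ] with z hz using ENNReal.add_ne_top.2 ⟨ENNReal.one_ne_top, hz.ne⟩)
  have hbasic : ∀ S ∈ countEvents (μ.withDensity fun z => 1 + meanWeight μ ψ z),
      ∫ γ in S, F γ ∂(poissonLaw μ) = 0 := by
    intro S hS
    have hSm := measurableSet_countEvents hS
    have hmem : indicatorConstLp 2 hSm (measure_ne_top (poissonLaw μ) S) (1 : ℝ) ∈ domain μ ψ :=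
      (energy_congr indicatorConstLp_coeFn).trans_lt (energy_indicator_lt_top hψ hS)
    rw [← L2.inner_indicatorConstLp_one (𝕜 := ℝ) hSm (measure_ne_top _ _)]
    exact (Submodule.mem_orthogonal _ _).1 hF _ hmem
  have huniv : ∫ γ, F γ ∂(poissonLaw μ) = 0 := by
    rw [← setIntegral_univ]
    exact hbasic _ ⟨Empty, inferInstance, Empty.elim, Set.univ, fun i => i.elim, fun i => i.elim,
      MeasurableSet.univ, by simp⟩
  have hall : ∀ S, MeasurableSet S → ∫ γ in S, F γ ∂(poissonLaw μ) = 0 := by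
    intro S hS
    induction S, hS using MeasurableSpace.induction_on_inter
      (generateFrom_countEvents (μ.withDensity fun z => 1 + meanWeight μ ψ z))
      (isPiSystem_countEvents _) with
    | empty => simp
    | basic S hS => exact hbasic S hS
    | compl S hS ih =>
      have := integral_add_compl hS hint
      rw [ih, huniv] at this
      simpa using this
    | iUnion f hd hm ih =>
      rw [integral_iUnion hm hd hint.integrableOn]
      simp [ih]
  refine (Lp.eq_zero_iff_ae_eq_zero).2 ?_
  exact Lp.ae_eq_zero_of_forall_setIntegral_eq_zero F two_ne_zero ENNReal.ofNat_ne_top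
    (fun S _ _ => hint.integrableOn) fun S hS _ => hall S hS

/-- The limit `v` exists in `L²`; lower semicontinuity of the energy then passes the Cauchy estimate
to it. -/
theorem exists_limit_mem_domain (hψ : Measurable (Function.uncurry ψ))
    (u : ℕ → Lp ℝ 2 (poissonLaw μ)) (hu : ∀ n, u n ∈ domain μ ψ)
    (hc : ∀ ε > 0, ∃ N, ∀ m ≥ N, ∀ n ≥ N,
      form μ ψ ⇑(u m - u n) ⇑(u m - u n) + ‖u m - u n‖ ^ 2 < ε) :
    ∃ v ∈ domain μ ψ,
      Tendsto (fun n => form μ ψ ⇑(u n - v) ⇑(u n - v) + ‖u n - v‖ ^ 2) atTop (𝓝 0) := by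
  have hself : ∀ w : Lp ℝ 2 (poissonLaw μ), form μ ψ w w = (energy μ ψ w).toReal := fun w =>
    form_self hψ (Lp.aestronglyMeasurable w)
  have hsub : ∀ v ∈ domain μ ψ, ∀ w ∈ domain μ ψ, v - w ∈ domain μ ψ := fun v hv w hw =>
    (domainSubmodule μ hψ).sub_mem hv hw
  have hcauchy : CauchySeq u := by
    refine Metric.cauchySeq_iff.2 fun ε hε => ?_
    obtain ⟨N, hN⟩ := hc (ε ^ 2) (by positivity)
    refine ⟨N, fun m hm n hn => ?_⟩
    rw [dist_eq_norm]
    refine lt_of_pow_lt_pow_left₀ 2 hε.le (lt_of_le_of_lt ?_ (hN m hm n hn))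
    rw [hself]
    exact le_add_of_nonneg_left ENNReal.toReal_nonneg
  obtain ⟨v, hv⟩ := cauchySeq_tendsto_of_complete hcauchy
  obtain ⟨ns, hns, hae⟩ := (tendstoInMeasure_of_tendsto_Lp hv).exists_seq_tendsto_ae
  -- Here `m` is fixed and the other index runs to infinity along the a.e. convergent subsequence
  -- `ns`.
  have key : ∀ ε > 0, ∃ N, ∀ m ≥ N, energy μ ψ ⇑(u m - v) ≤ ENNReal.ofReal ε := by
    intro ε hε
    obtain ⟨N, hN⟩ := hc ε hε
    refine ⟨N, fun m hm => ?_⟩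
    refine (energy_le_liminf (F := fun k => ⇑(u m - u (ns k))) hψ
      (fun k => Lp.aestronglyMeasurable _) ?_).trans ?_
    · filter_upwards [hae, Lp.coeFn_sub (u m) v,
        ae_all_iff.2 fun k => Lp.coeFn_sub (u m) (u (ns k))] with γ h₁ h₂ h₃
      simp only [h₂, h₃, Pi.sub_apply]
      exact tendsto_const_nhds.sub h₁
    · refine liminf_le_of_frequently_le' (Eventually.frequently ?_)
      filter_upwards [eventually_ge_atTop N] with k hk
      have h := hN m hm (ns k) (hk.trans hns.le_apply)
      rw [hself] at h
      -- The hypothesis bounds only `toReal` of the energy. Finiteness on the domain excludes the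
      -- value `∞`, which `toReal` would hide.
      rw [← ENNReal.ofReal_toReal (hsub _ (hu m) _ (hu (ns k))).ne]
      exact ENNReal.ofReal_le_ofReal (by nlinarith [sq_nonneg ‖u m - u (ns k)‖])
  refine ⟨v, ?_, ?_⟩
  · obtain ⟨N, hN⟩ := key 1 one_pos
    -- Membership of `v` follows from `v = u N - (u N - v)`.
    have h : u N - v ∈ domain μ ψ := (hN N le_rfl).trans_lt ENNReal.ofReal_lt_top
    simpa using hsub _ (hu N) _ h
  · have h1 : Tendsto (fun n => form μ ψ ⇑(u n - v) ⇑(u n - v)) atTop (𝓝 0) := by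
      refine Metric.tendsto_atTop.2 fun ε hε => ?_
      obtain ⟨N, hN⟩ := key (ε / 2) (by positivity)
      refine ⟨N, fun n hn => ?_⟩
      rw [hself, Real.dist_0_eq_abs, abs_of_nonneg ENNReal.toReal_nonneg]
      exact (ENNReal.toReal_le_of_le_ofReal (by positivity) (hN n hn)).trans_lt (by linarith)
    have h2 : Tendsto (fun n => ‖u n - v‖ ^ 2) atTop (𝓝 0) := by
      simpa using (tendsto_iff_norm_sub_tendsto_zero.1 hv).pow 2
    simpa using h1.add h2

theorem isSymmetricDirichletForm (hψ : Measurable (Function.uncurry ψ))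
    (hψμ : ∀ᵐ z ∂μ, meanWeight μ ψ z < ∞) :
    IsSymmetricDirichletForm (poissonLaw μ) (domain μ ψ) fun F G => form μ ψ F G where
  zero_mem := (domainSubmodule μ hψ).zero_mem
  add_mem _ hu _ hv := add_mem_domain hψ hu hv
  smul_mem c _ hu := smul_mem_domain c hu
  dense := dense_domain hψ hψμ
  add_left u hu v hv w hw := by
    have hm := fun u : Lp ℝ 2 (poissonLaw μ) => Lp.aestronglyMeasurable u
    rw [form_congr (Lp.coeFn_add u v) (ae_eq_refl _)]
    unfold form
    rw [← integral_add (integrable_form_integrand hψ (hm u) (hm w) hu hw)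
      (integrable_form_integrand hψ (hm v) (hm w) hv hw)]
    congr 1
    funext p
    simp only [difference, Pi.add_apply]
    ring
  smul_left c u _ v _ := by
    rw [form_congr (Lp.coeFn_smul c u) (ae_eq_refl _)]
    unfold form
    rw [← integral_const_mul]
    congr 1
    funext p
    simp only [difference, Pi.smul_apply, smul_eq_mul]
    ring
  symm u _ v _ := by
    unfold form
    congr 1
    funext p
    ring
  nonneg u _ := by
    rw [form_self hψ (Lp.aestronglyMeasurable u)]
    exact ENNReal.toReal_nonneg
  closed := exists_limit_mem_domain hψ
  contraction φ hφ h0 u hu := by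
    have h : energy μ ψ (hφ.compLp h0 u) ≤ energy μ ψ u :=
      (energy_congr (hφ.coeFn_compLp h0 u)).trans_le (energy_comp_le hφ u)
    refine ⟨h.trans_lt hu, ?_⟩
    rw [form_self hψ (Lp.aestronglyMeasurable _), form_self hψ (Lp.aestronglyMeasurable _)]
    exact ENNReal.toReal_mono (ne_of_lt hu) h

/-- Differences of constants vanish, so the resolvent equation for `α⁻¹ • 1` reduces to `α ⟨α⁻¹ • 1,
v⟩ = ⟨1, v⟩`. -/
theorem isConservative (μ : Measure E) [SigmaFinite μ] (ψ : Configuration E → E → ℝ≥0) :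
    IsConservative (domain μ ψ) fun F G => form μ ψ F G where
  one_mem := const_mem_domain 1
  form_one := by rw [form_congr (Lp.coeFn_const ..) (ae_eq_refl _), form_const_left]
  resolvent_one α hα := by
    refine ⟨smul_mem_domain _ (const_mem_domain 1), fun v _ => ?_⟩
    have h : ⇑(α⁻¹ • Lp.const 2 (poissonLaw μ) (1 : ℝ)) =ᵐ[poissonLaw μ]
        Function.const _ (α⁻¹ * 1) := by
      filter_upwards [Lp.coeFn_smul α⁻¹ (Lp.const 2 (poissonLaw μ) (1 : ℝ)),
        Lp.coeFn_const 2 (poissonLaw μ) (1 : ℝ)] with γ h₁ h₂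
      rw [h₁, Pi.smul_apply, h₂]
      rfl
    beta_reduce
    rw [form_congr h (ae_eq_refl _), form_const_left, zero_add, real_inner_smul_left,
      mul_inv_cancel_left₀ hα.ne']

end Domain

end PoissonSpace

theorem proposition3p3 {E : Type*} [TopologicalSpace E] [PolishSpace E] [MeasurableSpace E]
    [BorelSpace E] (μ : Measure E) [SigmaFinite μ]
    (ψ : PoissonSpace.Configuration E → E → ℝ≥0) (hψ : Measurable (Function.uncurry ψ))
    (hψμ : ∀ᵐ z ∂μ, PoissonSpace.meanWeight μ ψ z < ∞) :
    -- quasi-invariance of `γ ↦ γ + δ_z`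
    Measure.QuasiMeasurePreserving
      (fun p : PoissonSpace.Configuration E × E => PoissonSpace.addPoint p.1 p.2)
      ((PoissonSpace.poissonLaw μ).prod μ) (PoissonSpace.poissonLaw μ) ∧
    -- the form does not depend on the choice of versions
    (∀ F F' G G' : PoissonSpace.Configuration E → ℝ,
      F =ᵐ[PoissonSpace.poissonLaw μ] F' → G =ᵐ[PoissonSpace.poissonLaw μ] G' →
        PoissonSpace.energy μ ψ F = PoissonSpace.energy μ ψ F' ∧
        PoissonSpace.form μ ψ F G = PoissonSpace.form μ ψ F' G') ∧
    -- the integral defining the form converges absolutely on the domain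
    (∀ F ∈ PoissonSpace.domain μ ψ, ∀ G ∈ PoissonSpace.domain μ ψ,
      Integrable (fun p : PoissonSpace.Configuration E × E =>
        PoissonSpace.difference F p * PoissonSpace.difference G p * ψ p.1 p.2)
        ((PoissonSpace.poissonLaw μ).prod μ)) ∧
    PoissonSpace.IsSymmetricDirichletForm (PoissonSpace.poissonLaw μ) (PoissonSpace.domain μ ψ)
      (fun F G => PoissonSpace.form μ ψ F G) ∧
    PoissonSpace.IsConservative (PoissonSpace.domain μ ψ)
      (fun F G => PoissonSpace.form μ ψ F G) ∧
    -- the domain contains the (classes of the) cylindrical functions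
    (∀ F ∈ PoissonSpace.cylindrical μ ψ,
      ∃ hF : MemLp F 2 (PoissonSpace.poissonLaw μ), hF.toLp F ∈ PoissonSpace.domain μ ψ) := by
  refine ⟨PoissonSpace.quasiMeasurePreserving_addPoint μ, fun F F' G G' hF hG =>
    ⟨PoissonSpace.energy_congr hF, PoissonSpace.form_congr hF hG⟩, fun F hF G hG =>
    PoissonSpace.integrable_form_integrand hψ (Lp.aestronglyMeasurable F)
      (Lp.aestronglyMeasurable G) hF hG, PoissonSpace.isSymmetricDirichletForm hψ hψμ,
    PoissonSpace.isConservative μ ψ, fun F hF =>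
    ⟨PoissonSpace.memLp_of_mem_cylindrical hF, ?_⟩⟩
  exact (PoissonSpace.energy_congr (PoissonSpace.memLp_of_mem_cylindrical hF).coeFn_toLp).trans_lt
    (PoissonSpace.energy_lt_top_of_mem_cylindrical hψ hF)
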